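/- Let $A$ be a unital $C^*$-algebra, let $\mathfrak A=*_{i=1}^\infty A$ be the universal unital $C^*$-algebra free product of countably infinitely many copies of $A$, with canonical $*$-homomorphisms $\lambda_i:A\to\mathfrak A$, and let $\mathfrak A_0\subseteq\mathfrak A$ be the $*$-algebra generated by $\bigcup_i\lambda_i(A)$. Let $\psi$ be a symmetric state on $\mathfrak A$, that is, a state with $$\psi(\lambda_{i(1)}(a_1)\cdots\lambda_{i(n)}(a_n))=\psi(\lambda_{\sigma(i(1))}(a_1)\cdots\lambda_{\sigma(i(n))}(a_n))$$ for all $n$, all $i(1),\dots,i(n)\in\mathbb N$, all $a_1,\dots,a_n\in A$ and all permutations $\sigma$ of $\mathbb N$. Let $\pi_\psi:\mathfrak A\to B(L^2(\mathfrak A,\psi))$ be the GNS representation of $\psi$ with canonical map $a\mapsto\hat a$, put $\pi_i=\pi_\psi\circ\lambda_i$, $\mathcal M_\psi=\pi_\psi(\mathfrak A)''$, and let $\hat\psi=\langle\,\cdot\,\hat 1,\hat 1\rangle$ be the vector state. Let $S_\infty$ be the group of permutations of $\mathbb N$ that move only finitely many points; for $\sigma\in S_\infty$ let $\beta_\sigma$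 be the automorphism of $\mathfrak A$ with $\beta_\sigma\circ\lambda_i=\lambda_{\sigma(i)}$, let $U_\sigma$ be the unitary with $U_\sigma\hat x=\widehat{\beta_\sigma(x)}$, and let $\hat\beta_\sigma=U_\sigma(\cdot)U_\sigma^*$. Let $$\mathcal F_\psi=\{x\in\mathcal M_\psi:\hat\beta_\sigma(x)=x\text{ for all }\sigma\in S_\infty\},\qquad \mathcal T_\psi=\bigcap_{N\ge1}W^*\Big(\bigcup_{i\ge N}\pi_i(A)\Big)$$ be the fixed point algebra and the tail algebra of $\psi$, and let $\mathcal R_\psi$ and $\mathcal Q_\psi$ be the norm closures of the $*$-algebras generated by $\mathcal F_\psi\cup\pi_\psi(\mathfrak A_0)$ and by $\mathcal T_\psi\cup\pi_\psi(\mathfrak A_0)$, respectively, i.e. $\mathcal R_\psi=C^*(\pi_\psi(\mathfrak A)\cup\mathcal F_\psi)$ and $\mathcal Q_\psi=C^*(\pi_\psi(\mathfrak A)\cup\mathcal T_\psi)$. Then there is a unique $*$-endomorphism $\alpha$ of $\mathcal R_\psi$ (the shift) with $\alpha\circ\pi_i=\pi_{i+1}$ for all $i$ and $\alpha|_{\mathcal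 F_\psi}=\mathrm{id}$, and there is a conditional expectation (i.e. a projection of norm $1$) $G_\psi$ from $\mathcal R_\psi$ onto $\mathcal F_\psi$ given by $$G_\psi(x)=\mathrm{WOT}\text{-}\lim_{n\to\infty}\alpha^n(x)\qquad(x\in\mathcal R_\psi),$$ the limit existing in the weak operator topology. It satisfies: 1. $\hat\psi\circ G_\psi=\hat\psi|_{\mathcal R_\psi}$; 2. $G_\psi\circ\alpha=G_\psi$; 3. for all $\sigma\in S_\infty$, $\hat\beta_\sigma$ maps $\mathcal R_\psi$ into itself and $G_\psi\circ\hat\beta_\sigma|_{\mathcal R_\psi}=G_\psi$; 4. $\mathcal Q_\psi\subseteq\mathcal R_\psi$, and the restriction $F_\psi$ of $G_\psi$ to $\mathcal Q_\psi$ is a conditional expectation (a projection of norm $1$) from $\mathcal Q_\psi$ onto $\mathcal T_\psi$. -/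

import Mathlib

open scoped ComplexOrder ENNReal

universe u

namespace SymState

theorem starAlgHom_continuous {B C : Type*} [CStarAlgebra B] [CStarAlgebra C]
    (f : B →⋆ₐ[ℂ] C) : Continuous f :=
  AddMonoidHomClass.continuous_of_bound f 1 fun x => by
    simpa using NonUnitalStarAlgHom.norm_apply_le f x

/-! ### The universal unital free product of infinitely many copies of a unital C⋆-algebra -/

section FreeProduct

variable (A : Type u) [CStarAlgebra A]

/-- A sequence of unital `*`-homomorphisms from `A` into one and the same unital C⋆-algebra. -/
structure RepFamily : Type (u + 1) where
  alg : Type u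
  [cstar : CStarAlgebra alg]
  [nontriv : Nontrivial alg]
  hom : ℕ → A →⋆ₐ[ℂ] alg

attribute [instance] RepFamily.cstar RepFamily.nontriv

/-- The `ℓ^∞`-product of the target algebras of all sequences of representations. -/
abbrev BigProduct : Type (u + 1) := lp (fun P : RepFamily A => P.alg) ∞

noncomputable instance : CStarAlgebra (BigProduct A) where

/-- The `i`-th copy of `A`, placed diagonally in the product over all sequences. -/
noncomputable def diag (i : ℕ) : A →⋆ₐ[ℂ] BigProduct A where
  toFun a := ⟨fun P => P.hom i a,
    memℓp_infty ⟨‖a‖, by rintro _ ⟨P, rfl⟩; exact NonUnitalStarAlgHom.norm_apply_le (P.hom i) a⟩⟩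
  map_one' := by ext P; exact map_one (P.hom i)
  map_mul' a b := by ext P; exact map_mul (P.hom i) a b
  map_zero' := by ext P; exact map_zero (P.hom i)
  map_add' a b := by ext P; exact map_add (P.hom i) a b
  commutes' r := by ext P; exact AlgHomClass.commutes (P.hom i) r
  map_star' a := by ext P; exact map_star (P.hom i) a

/-- The universal free product, as a closed `*`-subalgebra of the product. -/
noncomputable def freeSubalgebra : StarSubalgebra ℂ (BigProduct A) :=
  (StarAlgebra.adjoin ℂ (⋃ i, Set.range (diag A i))).topologicalClosure

/-- The universal unital C⋆-algebra free product `𝔄` of countably infinitely many copies of `A`. -/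
def FreeProd : Type (u + 1) := freeSubalgebra A

noncomputable instance : CStarAlgebra (FreeProd A) :=
  haveI : IsClosed (freeSubalgebra A : Set (BigProduct A)) :=
    StarSubalgebra.isClosed_topologicalClosure _
  inferInstanceAs (CStarAlgebra (freeSubalgebra A))

/-- The usual order of a C⋆-algebra: `0 ≤ x` iff `x` is self-adjoint with nonnegative spectrum. -/
noncomputable instance : PartialOrder (FreeProd A) := CStarAlgebra.spectralOrder _

instance : StarOrderedRing (FreeProd A) := CStarAlgebra.spectralOrderedRing _

variable {A}

/-- The canonical `*`-homomorphism `λᵢ : A → 𝔄` onto the `i`-th copy (indices start at `0`). -/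
noncomputable def lam (i : ℕ) : A →⋆ₐ[ℂ] FreeProd A :=
  (diag A i).codRestrict (freeSubalgebra A) fun a =>
    StarSubalgebra.le_topologicalClosure _
      (StarAlgebra.subset_adjoin ℂ _ (Set.mem_iUnion.2 ⟨i, a, rfl⟩))

variable (A) in
/-- The `*`-subalgebra `𝔄₀` of `𝔄` generated algebraically by the copies of `A`. -/
noncomputable def algFreeProd : StarSubalgebra ℂ (FreeProd A) :=
  StarAlgebra.adjoin ℂ (⋃ i, Set.range (lam (A := A) i))

theorem algFreeProd_dense : (algFreeProd A).topologicalClosure = ⊤ := by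
  let ι : FreeProd A →⋆ₐ[ℂ] BigProduct A := (freeSubalgebra A).subtype
  have hι : Topology.IsClosedEmbedding ι :=
    (StarSubalgebra.isClosed_topologicalClosure _).isClosedEmbedding_subtypeVal
  have h1 : (algFreeProd A).map ι = StarAlgebra.adjoin ℂ (⋃ i, Set.range (diag A i)) := by
    rw [algFreeProd, StarAlgHom.map_adjoin, Set.image_iUnion]
    congr 1
    refine Set.iUnion_congr fun i => ?_
    rw [← Set.range_comp]
    rfl
  have h2 := StarSubalgebra.topologicalClosure_map (algFreeProd A) ι hι.isClosedMap hι.continuous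
  rw [h1] at h2
  rw [eq_top_iff]
  intro x _
  have hx : ι x ∈ (StarAlgebra.adjoin ℂ (⋃ i, Set.range (diag A i))).topologicalClosure := x.2
  rw [h2] at hx
  obtain ⟨y, hy, hyx⟩ := hx
  rwa [← hι.injective hyx]

/-- Homomorphisms out of `𝔄` that agree on the copies of `A` are equal. -/
theorem hom_ext {B : Type*} [CStarAlgebra B] {f g : FreeProd A →⋆ₐ[ℂ] B}
    (h : ∀ i a, f (lam i a) = g (lam i a)) : f = g := by
  have h1 : algFreeProd A ≤ StarAlgHom.equalizer f g := by
    refine StarAlgebra.adjoin_le ?_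
    intro x hx
    obtain ⟨i, a, rfl⟩ := Set.mem_iUnion.1 hx
    exact h i a
  have h2 : IsClosed (StarAlgHom.equalizer f g : Set (FreeProd A)) :=
    isClosed_eq (starAlgHom_continuous f) (starAlgHom_continuous g)
  have h3 := StarSubalgebra.topologicalClosure_minimal h1 h2
  rw [algFreeProd_dense] at h3
  ext x
  exact h3 (Set.mem_univ x)

/-- The homomorphism `𝔄 → B` induced by a sequence of unital `*`-homomorphisms `A → B`. -/
noncomputable def projHom (P : RepFamily A) : FreeProd A →⋆ₐ[ℂ] P.alg where
  toFun x := (x.1 : ∀ P : RepFamily A, P.alg) P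
  map_one' := rfl
  map_mul' _ _ := rfl
  map_zero' := rfl
  map_add' _ _ := rfl
  commutes' _ := rfl
  map_star' _ := rfl

section Universal

universe v

/-- A C⋆-algebra whose underlying type is small is isomorphic to one in the given universe. -/
theorem exists_small_model (S : Type v) [CStarAlgebra S] [Small.{u} S] :
    ∃ (T : Type u) (_ : CStarAlgebra T), Nonempty (T ≃⋆ₐ[ℂ] S) := by
  let e : Shrink.{u} S ≃ₐ[ℂ] S := Shrink.algEquiv ℂ S
  have he : Function.Injective e := e.injective
  let i1 : NormedRing (Shrink.{u} S) := NormedRing.induced (Shrink.{u} S) S e he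
  let i2 : StarRing (Shrink.{u} S) :=
    { star := fun x => e.symm (star (e x))
      star_involutive := fun x => by simp
      star_mul := fun x y => by simp
      star_add := fun x y => by simp }
  have hstar : ∀ x : Shrink.{u} S, e (star x) = star (e x) := fun x => e.apply_symm_apply _
  have hnorm : ∀ x : Shrink.{u} S, ‖x‖ = ‖e x‖ := fun x => rfl
  have hiso : Isometry e := AddMonoidHomClass.isometry_of_norm e fun x => (hnorm x).symm
  let i3 : CStarAlgebra (Shrink.{u} S) :=
    { i1, i2 with
      toCompleteSpace :=
        (completeSpace_congr (e := e.toEquiv) hiso.isUniformEmbedding).2 inferInstance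
      norm_mul_self_le := fun x => by
        rw [hnorm, hnorm, map_mul, hstar, CStarRing.norm_star_mul_self]
      toAlgebra := inferInstance
      norm_smul_le := fun r x => by
        rw [hnorm, hnorm, map_smul, norm_smul]
      star_smul := fun r x => he (by
        rw [hstar, map_smul, map_smul, star_smul, hstar]) }
  exact ⟨Shrink.{u} S, i3, ⟨StarAlgEquiv.ofAlgEquiv e hstar⟩⟩

/-- The universal property of `𝔄`, for target C⋆-algebras in an arbitrary universe. -/
theorem existsUnique_lift {B : Type v} [CStarAlgebra B] (π : ℕ → A →⋆ₐ[ℂ] B) :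
    ∃! Φ : FreeProd A →⋆ₐ[ℂ] B, ∀ i a, Φ (lam i a) = π i a := by
  refine existsUnique_of_exists_of_unique ?_
    fun f g hf hg => hom_ext fun i a => (hf i a).trans (hg i a).symm
  let f : ℕ × A → B := fun p => π p.1 p.2
  let S₀ : StarSubalgebra ℂ B := StarAlgebra.adjoin ℂ (Set.range f)
  let S : StarSubalgebra ℂ B := S₀.topologicalClosure
  have hS : IsClosed (S : Set B) := StarSubalgebra.isClosed_topologicalClosure _
  have hstar : star (Set.range f) = Set.range f := by
    ext x
    constructor
    · rintro ⟨p, hp⟩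
      exact ⟨(p.1, star p.2), by simp [f] at hp ⊢; rw [map_star, hp, star_star]⟩
    · rintro ⟨p, rfl⟩
      exact ⟨(p.1, star p.2), by simp [f, map_star]⟩
  have hS₀ : (S₀ : Set B) = Set.range (FreeAlgebra.lift ℂ f) := by
    have : S₀.toSubalgebra = (FreeAlgebra.lift ℂ f).range := by
      rw [StarAlgebra.adjoin_toSubalgebra, hstar, Set.union_self,
        Algebra.adjoin_range_eq_range_freeAlgebra_lift]
    exact congrArg (fun T : Subalgebra ℂ B => (T : Set B)) this
  have : Small.{u} (S₀ : Set B) := by rw [hS₀]; infer_instance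
  have : Small.{u} S := by
    have h : ∀ x : S, ∃ s : ℕ → (S₀ : Set B),
        Filter.Tendsto (fun n => (s n : B)) Filter.atTop (nhds (x : B)) := by
      intro x
      have hx : (x : B) ∈ closure (S₀ : Set B) := x.2
      obtain ⟨s, hs, hlim⟩ := mem_closure_iff_seq_limit.1 hx
      exact ⟨fun n => ⟨s n, hs n⟩, hlim⟩
    choose s hs using h
    refine small_of_injective (f := s) fun x y hxy => Subtype.ext ?_
    have hx := hs x
    rw [hxy] at hx
    exact tendsto_nhds_unique hx (hs y)
  obtain ⟨T, hT, ⟨e⟩⟩ := exists_small_model.{u} S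
  have hmem : ∀ i a, π i a ∈ S := fun i a =>
    StarSubalgebra.le_topologicalClosure _ (StarAlgebra.subset_adjoin ℂ _ ⟨(i, a), rfl⟩)
  let ρ : ℕ → A →⋆ₐ[ℂ] T := fun i =>
    (e.symm : S →⋆ₐ[ℂ] T).comp ((π i).codRestrict S (hmem i))
  cases subsingleton_or_nontrivial T with
  | inr h =>
    exact ⟨S.subtype.comp ((e : T →⋆ₐ[ℂ] S).comp (projHom ⟨T, ρ⟩)), fun i a => by
      change ((e (e.symm _) : S) : B) = _
      rw [e.apply_symm_apply]; rfl⟩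
  | inl h =>
    have hB : Subsingleton B := by
      have : (1 : S) = 0 := e.symm.injective (Subsingleton.elim _ _)
      exact subsingleton_of_zero_eq_one (congrArg Subtype.val this).symm
    exact ⟨{ toFun := fun _ => 0
             map_one' := Subsingleton.elim _ _
             map_mul' := fun _ _ => Subsingleton.elim _ _
             map_zero' := rfl
             map_add' := fun _ _ => Subsingleton.elim _ _
             commutes' := fun _ => Subsingleton.elim _ _
             map_star' := fun _ => Subsingleton.elim _ _ }, fun _ _ => Subsingleton.elim _ _⟩

end Universal

/-- The `*`-homomorphism `𝔄 → B` induced by a sequence of unital `*`-homomorphisms `A → B`. -/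
noncomputable def lift {B : Type*} [CStarAlgebra B] (π : ℕ → A →⋆ₐ[ℂ] B) :
    FreeProd A →⋆ₐ[ℂ] B :=
  (existsUnique_lift π).choose

theorem lift_lam {B : Type*} [CStarAlgebra B] (π : ℕ → A →⋆ₐ[ℂ] B) (i : ℕ) (a : A) :
    lift π (lam i a) = π i a :=
  (existsUnique_lift π).choose_spec.1 i a

/-- The `*`-automorphism `β_σ` of `𝔄` with `β_σ ∘ λᵢ = λ_{σ(i)}`. -/
noncomputable def beta (σ : Equiv.Perm ℕ) : FreeProd A →⋆ₐ[ℂ] FreeProd A :=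
  lift fun i => lam (σ i)

theorem beta_lam (σ : Equiv.Perm ℕ) (i : ℕ) (a : A) : beta σ (lam i a) = lam (σ i) a :=
  lift_lam _ i a

theorem beta_beta (σ τ : Equiv.Perm ℕ) (x : FreeProd A) : beta σ (beta τ x) = beta (σ * τ) x := by
  have : (beta σ).comp (beta τ) = beta (A := A) (σ * τ) :=
    hom_ext fun i a => by simp [beta_lam]
  exact DFunLike.congr_fun this x

theorem beta_one (x : FreeProd A) : beta 1 x = x := by
  have : beta 1 = StarAlgHom.id ℂ (FreeProd A) := hom_ext fun i a => by simp [beta_lam]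
  exact DFunLike.congr_fun this x

end FreeProduct

/-! ### Operator algebras on a Hilbert space -/

section Operators

variable {H : Type*} [NormedAddCommGroup H] [InnerProductSpace ℂ H] [CompleteSpace H]

/-- The von Neumann algebra `W*(S) = (S ∪ S*)''` generated by a set `S` of operators. -/
noncomputable def vonNeumannGenerated (S : Set (H →L[ℂ] H)) : VonNeumannAlgebra H where
  toStarSubalgebra :=
    StarSubalgebra.centralizer ℂ (StarSubalgebra.centralizer ℂ S : Set (H →L[ℂ] H))
  centralizer_centralizer' := by
    change Set.centralizer (Set.centralizer (StarSubalgebra.centralizer ℂ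
      (StarSubalgebra.centralizer ℂ S : Set (H →L[ℂ] H)) : Set (H →L[ℂ] H))) = _
    rw [StarSubalgebra.coe_centralizer, Set.centralizer_centralizer_centralizer]
    rfl

theorem conj_star (e : H ≃ₗᵢ[ℂ] H) (x : H →L[ℂ] H) :
    e.conjStarAlgEquiv (star x) = star (e.conjStarAlgEquiv x) := map_star _ x

/-- `E` is a conditional expectation (a projection of norm `1`) from the `*`-algebra `B` of
operators onto its `*`-subalgebra `D`. -/
structure IsConditionalExpectation (B D : StarSubalgebra ℂ (H →L[ℂ] H))
    (E : B →L[ℂ] (H →L[ℂ] H)) : Prop where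
  le : D ≤ B
  mem : ∀ x : B, E x ∈ D
  apply_of_mem : ∀ x : B, (x : H →L[ℂ] H) ∈ D → E x = x
  norm_eq_one : ‖E‖ = 1

/-- The restriction of a bounded linear map on `C` to a smaller `*`-algebra `B`. -/
noncomputable def restrictTo {B C : StarSubalgebra ℂ (H →L[ℂ] H)} (h : B ≤ C)
    (E : C →L[ℂ] (H →L[ℂ] H)) : B →L[ℂ] (H →L[ℂ] H) where
  toFun x := E (StarSubalgebra.inclusion h x)
  map_add' x y := by rw [map_add, map_add]
  map_smul' c x := by rw [map_smul, map_smul]; rfl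
  cont := E.continuous.comp (StarSubalgebra.isEmbedding_inclusion h).continuous

end Operators

/-! ### Symmetric states and their GNS representations -/

section Symmetric

/-- A sequence of unital `*`-homomorphisms `πᵢ : A → B` is exchangeable with respect to `φ` if
`φ(π_{i(1)}(a₁)⋯π_{i(n)}(aₙ)) = φ(π_{σ(i(1))}(a₁)⋯π_{σ(i(n))}(aₙ))` for all permutations `σ`
of the index set; the word is given as the list of the pairs `(i(k), a_k)`. -/
def IsExchangeable {A B : Type*} [CStarAlgebra A] [CStarAlgebra B] (φ : B → ℂ)
    (π : ℕ → A →⋆ₐ[ℂ] B) : Prop :=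
  ∀ (σ : Equiv.Perm ℕ) (w : List (ℕ × A)),
    φ (w.map fun p => π p.1 p.2).prod = φ (w.map fun p => π (σ p.1) p.2).prod

/-- A symmetric state on `𝔄`: a positive unital linear functional for which `(λᵢ)` is
exchangeable. -/
structure SymmetricState (A : Type u) [CStarAlgebra A] : Type (u + 1) where
  functional : FreeProd A →ₚ[ℂ] ℂ
  map_one : functional 1 = 1
  exchangeable : IsExchangeable functional (lam (A := A))

variable {A : Type u} [CStarAlgebra A]

/-- Membership in the group `S_∞` of the permutations that move only finitely many indices. -/
def IsFinitary (σ : Equiv.Perm ℕ) : Prop := {i | σ i ≠ i}.Finite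

namespace SymmetricState

variable (ψ : SymmetricState A)

theorem functional_beta (σ : Equiv.Perm ℕ) (x : FreeProd A) :
    ψ.functional (beta σ x) = ψ.functional x := by
  have hcl : IsClosed {x : FreeProd A | ψ.functional (beta σ x) = ψ.functional x} :=
    isClosed_eq ((map_continuous ψ.functional).comp
      (starAlgHom_continuous (beta σ))) (map_continuous ψ.functional)
  have hstar : star (⋃ i, Set.range (lam (A := A) i)) ⊆ ⋃ i, Set.range (lam (A := A) i) := by
    intro x hx
    obtain ⟨i, a, ha⟩ := Set.mem_iUnion.1 hx
    exact Set.mem_iUnion.2 ⟨i, star a, by rw [map_star, ha, star_star]⟩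
  have hsub : (algFreeProd A : Set (FreeProd A)) ⊆
      {x : FreeProd A | ψ.functional (beta σ x) = ψ.functional x} := by
    intro x hx
    have hx' : x ∈ Subalgebra.toSubmodule (algFreeProd A).toSubalgebra := hx
    rw [algFreeProd, StarAlgebra.adjoin_eq_span] at hx'
    refine Submodule.span_induction ?_ (by simp) ?_ ?_ hx'
    · intro y hy
      obtain ⟨l, hl, rfl⟩ := Submonoid.exists_list_of_mem_closure hy
      have hl' : ∀ y ∈ l, ∃ p : ℕ × A, lam p.1 p.2 = y := by
        intro y hy
        obtain ⟨i, a, ha⟩ := Set.mem_iUnion.1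
          ((hl y hy).elim id fun h => hstar h)
        exact ⟨(i, a), ha⟩
      have : ∃ w : List (ℕ × A), l = w.map fun p => lam p.1 p.2 := by
        clear hl hy
        induction l with
        | nil => exact ⟨[], rfl⟩
        | cons y l ih =>
          obtain ⟨w, hw⟩ := ih fun z hz => hl' z (List.mem_cons_of_mem _ hz)
          obtain ⟨p, hp⟩ := hl' y List.mem_cons_self
          exact ⟨p :: w, by simp [hw, hp]⟩
      obtain ⟨w, rfl⟩ := this
      change ψ.functional (beta σ _) = _
      rw [ψ.exchangeable σ w, map_list_prod, List.map_map]
      congr 3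
      funext p
      exact beta_lam σ p.1 p.2
    · intro y z _ _ hy hz
      change ψ.functional (beta σ _) = _
      rw [map_add, map_add, map_add, hy, hz]
    · intro c y _ hy
      change ψ.functional (beta σ _) = _
      rw [map_smul, map_smul, map_smul, hy]
  have : x ∈ (algFreeProd A).topologicalClosure := by rw [algFreeProd_dense]; trivial
  exact hcl.closure_subset_iff.2 hsub this

/-- The Hilbert space `L²(𝔄, ψ)`. -/
def H : Type (u + 1) := ψ.functional.GNS

noncomputable instance : NormedAddCommGroup ψ.H :=
  inferInstanceAs (NormedAddCommGroup ψ.functional.GNS)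

noncomputable instance : InnerProductSpace ℂ ψ.H :=
  inferInstanceAs (InnerProductSpace ℂ ψ.functional.GNS)

instance : CompleteSpace ψ.H := inferInstanceAs (CompleteSpace ψ.functional.GNS)

/-- The GNS representation `π_ψ : 𝔄 → B(L²(𝔄, ψ))`. -/
noncomputable def gns : FreeProd A →⋆ₐ[ℂ] (ψ.H →L[ℂ] ψ.H) := ψ.functional.gnsStarAlgHom

/-- The canonical map `a ↦ â` from `𝔄` to `L²(𝔄, ψ)`. -/
noncomputable def hat (a : FreeProd A) : ψ.H :=
  ((ψ.functional.toPreGNS a : ψ.functional.PreGNS) : ψ.functional.GNS)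

/-- The representations `πᵢ = π_ψ ∘ λᵢ` of `A`. -/
noncomputable def rep (i : ℕ) : A →⋆ₐ[ℂ] (ψ.H →L[ℂ] ψ.H) := ψ.gns.comp (lam i)

/-- The vector state `ψ̂ = ⟨ · 1̂, 1̂⟩`. -/
noncomputable def vectorState (x : ψ.H →L[ℂ] ψ.H) : ℂ := inner ℂ (ψ.hat 1) (x (ψ.hat 1))

/-- The map `x̂ ↦ (β_σ(x))^` before completion. -/
noncomputable def preU (σ : Equiv.Perm ℕ) : ψ.functional.PreGNS →ₗᵢ[ℂ] ψ.functional.PreGNS where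
  toLinearMap := ψ.functional.toPreGNS.toLinearMap ∘ₗ
    (beta σ : FreeProd A →⋆ₐ[ℂ] FreeProd A).toAlgHom.toLinearMap ∘ₗ
    ψ.functional.ofPreGNS.toLinearMap
  norm_map' x := by
    have h := ψ.functional_beta σ (star (ψ.functional.ofPreGNS x) * ψ.functional.ofPreGNS x)
    rw [map_mul, map_star] at h
    rw [PositiveLinearMap.preGNS_norm_def, PositiveLinearMap.preGNS_norm_def, ← h]
    rfl

/-- The extension of `preU` to the completion, a unitary with inverse given by `σ⁻¹`. -/
noncomputable def gnsU (σ : Equiv.Perm ℕ) : ψ.functional.GNS ≃ₗᵢ[ℂ] ψ.functional.GNS where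
  toLinearEquiv := LinearEquiv.ofLinearMap
    (ψ.preU σ).toContinuousLinearMap.completion.toLinearMap
    (ψ.preU σ⁻¹).toContinuousLinearMap.completion.toLinearMap
    (by
      ext x
      induction x using UniformSpace.Completion.induction_on with
      | hp =>
        exact isClosed_eq ((ψ.preU σ).toContinuousLinearMap.completion.continuous.comp
          (ψ.preU σ⁻¹).toContinuousLinearMap.completion.continuous) continuous_id
      | ih x =>
        simp [preU, beta_beta, beta_one])
    (by
      ext x
      induction x using UniformSpace.Completion.induction_on with
      | hp =>
        exact isClosed_eq ((ψ.preU σ⁻¹).toContinuousLinearMap.completion.continuous.comp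
          (ψ.preU σ).toContinuousLinearMap.completion.continuous) continuous_id
      | ih x =>
        simp [preU, beta_beta, beta_one])
  norm_map' x := by
    induction x using UniformSpace.Completion.induction_on with
    | hp =>
      exact isClosed_eq (ψ.preU σ).toContinuousLinearMap.completion.continuous.norm continuous_norm
    | ih x => simp

/-- The unitary `U_σ` on `L²(𝔄, ψ)` with `U_σ x̂ = (β_σ(x))^`. -/
noncomputable def U (σ : Equiv.Perm ℕ) : ψ.H ≃ₗᵢ[ℂ] ψ.H := ψ.gnsU σ

theorem U_hat (σ : Equiv.Perm ℕ) (x : FreeProd A) : ψ.U σ (ψ.hat x) = ψ.hat (beta σ x) :=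
  UniformSpace.Completion.map_coe (ψ.preU σ).toContinuousLinearMap.uniformContinuous _

theorem inner_hat (a b : FreeProd A) :
    inner ℂ (ψ.hat b) (ψ.hat a) = ψ.functional (star b * a) :=
  UniformSpace.Completion.inner_coe (𝕜 := ℂ) _ _

theorem gns_hat (a b : FreeProd A) : ψ.gns a (ψ.hat b) = ψ.hat (a * b) :=
  ψ.functional.gnsNonUnitalStarAlgHom_apply_coe (a := a) (b := ψ.functional.toPreGNS b)

theorem denseRange_hat : DenseRange ψ.hat :=
  (UniformSpace.Completion.denseRange_coe (α := ψ.functional.PreGNS)).comp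
    ψ.functional.toPreGNS.surjective.denseRange (UniformSpace.Completion.continuous_coe _)

/-- The automorphism `β̂_σ` of `B(L²(𝔄, ψ))`, conjugation by `U_σ`. -/
noncomputable def betaHat (σ : Equiv.Perm ℕ) : (ψ.H →L[ℂ] ψ.H) ≃⋆ₐ[ℂ] (ψ.H →L[ℂ] ψ.H) :=
  (ψ.U σ).conjStarAlgEquiv

/-- The von Neumann algebra `𝓜_ψ` generated by the image of `π_ψ`. -/
noncomputable def M : VonNeumannAlgebra ψ.H := vonNeumannGenerated (Set.range ψ.gns)

/-- The tail algebra `𝓣_ψ = ⋂_N W*(⋃_{i ≥ N} πᵢ(A))`. -/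
noncomputable def tail : StarSubalgebra ℂ (ψ.H →L[ℂ] ψ.H) :=
  ⨅ N : ℕ, (vonNeumannGenerated (⋃ i ≥ N, Set.range (ψ.rep i))).toStarSubalgebra

/-- The fixed point algebra `𝓕_ψ` of the action `β̂` of `S_∞` on `𝓜_ψ`. -/
noncomputable def fixed : StarSubalgebra ℂ (ψ.H →L[ℂ] ψ.H) where
  carrier := {x | x ∈ ψ.M ∧ ∀ σ : Equiv.Perm ℕ, IsFinitary σ → ψ.betaHat σ x = x}
  mul_mem' hx hy := ⟨mul_mem hx.1 hy.1, fun σ hσ => by rw [map_mul, hx.2 σ hσ, hy.2 σ hσ]⟩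
  add_mem' hx hy := ⟨add_mem hx.1 hy.1, fun σ hσ => by rw [map_add, hx.2 σ hσ, hy.2 σ hσ]⟩
  algebraMap_mem' r :=
    ⟨ψ.M.toStarSubalgebra.algebraMap_mem r, fun σ _ => AlgHomClass.commutes (ψ.betaHat σ) r⟩
  star_mem' hx := ⟨star_mem hx.1, fun σ hσ =>
    (conj_star _ _).trans (congrArg star (hx.2 σ hσ))⟩

/-- The C⋆-algebra `C*(π_ψ(𝔄) ∪ 𝓕_ψ)`: norm closure of the `*`-algebra generated by `𝓕_ψ` and
`π_ψ(𝔄₀)`. -/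
noncomputable def R : StarSubalgebra ℂ (ψ.H →L[ℂ] ψ.H) :=
  (StarAlgebra.adjoin ℂ ((ψ.fixed : Set (ψ.H →L[ℂ] ψ.H)) ∪
    ψ.gns '' (algFreeProd A))).topologicalClosure

/-- The C⋆-algebra `C*(π_ψ(𝔄) ∪ 𝓣_ψ)`: norm closure of the `*`-algebra generated by `𝓣_ψ` and
`π_ψ(𝔄₀)`. -/
noncomputable def Q : StarSubalgebra ℂ (ψ.H →L[ℂ] ψ.H) :=
  (StarAlgebra.adjoin ℂ ((ψ.tail : Set (ψ.H →L[ℂ] ψ.H)) ∪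
    ψ.gns '' (algFreeProd A))).topologicalClosure

theorem rep_mem_R (i : ℕ) (a : A) : ψ.rep i a ∈ ψ.R :=
  StarSubalgebra.le_topologicalClosure _ (StarAlgebra.subset_adjoin ℂ _
    (Or.inr ⟨lam i a, StarAlgebra.subset_adjoin ℂ _ (Set.mem_iUnion.2 ⟨i, a, rfl⟩), rfl⟩))

/-- `α` is the shift: `α ∘ πᵢ = πᵢ₊₁` for all `i`, and `α` is the identity on `𝓕_ψ`. -/
structure IsShift (α : ψ.R →⋆ₐ[ℂ] ψ.R) : Prop where
  map_rep : ∀ (i : ℕ) (a : A), α ⟨ψ.rep i a, ψ.rep_mem_R i a⟩ = ⟨ψ.rep (i + 1) a, ψ.rep_mem_R _ a⟩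
  map_fixed : ∀ x : ψ.R, (x : ψ.H →L[ℂ] ψ.H) ∈ ψ.fixed → α x = x

end SymmetricState

end Symmetric

end SymState

/-!
The algebra generated by `𝓕_ψ` and the operators `πᵢ(a)` is dense in `𝓡_ψ`, and each of its elements
`x` is local: `β̂_σ(x)` depends only on the values of `σ` at finitely many indices
(`exists_mem_localOps`). On local elements the shift is given by the automorphisms `β̂_σ` with
`σ(i) = i + 1` on a long initial segment; being a pointwise norm limit of `*`-automorphisms it extends
to a `*`-endomorphism of `𝓡_ψ` (`exists_shift`). Likewise `αⁿ(x) = β̂_σ(x)` as soon as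
`σ(i) = i + n` for the indices `i` of `x` (`IsShift.coe_iterate`).

All limits rest on `inner_betaHat_eq`. If `y` and `z` are vectors `â` with `a ∈ 𝔄₀`, they are fixed by
`U_σ` for every `σ` that fixes a certain finite set of indices. Once the indices of `x` are moved away
from that set, the matrix coefficient of the moved operator at `y` and `z` does not depend on where
they went: a finitary permutation carries one position to another and fixes `y` and `z`. Hence the
matrix coefficients of `αⁿ(x)` at such vectors are eventually constant, and by density and boundedness
`αⁿ(x)` converges in the weak operator topology for all `x ∈ 𝓡_ψ` (`IsShift.exists_limit`). The
same invariance gives `G_ψ ∘ β̂_σ = G_ψ` and `ψ̂ ∘ G_ψ = ψ̂`.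

The limit lies in `𝓕_ψ`, because a given `β̂_σ` fixes `αⁿ(x)` for all large `n`. For the tail algebra,
`U_σ` commutes with `πᵢ(A)` for all large `i`, whence `𝓣_ψ ⊆ 𝓕_ψ` (`tail_le_fixed`); and `αⁿ` maps
`𝓠_ψ` into `W*(⋃_{i ≥ n} πᵢ(A))`, which is closed in the weak operator topology, so that the limit
lies in `𝓣_ψ` (`IsShift.limit_mem_tail`).
-/

namespace SymState

/-! ### Limits of bounded sequences of operators -/

section Limits

open Filter Topology

/-- A uniformly Lipschitz sequence of maps that is pointwise Cauchy on a dense set is pointwise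
Cauchy. -/
theorem cauchySeq_of_lipschitz_of_dense {X Y : Type*} [PseudoMetricSpace X] [PseudoMetricSpace Y]
    {f : ℕ → X → Y} {C : ℝ} (hf : ∀ n x y, dist (f n x) (f n y) ≤ C * dist x y)
    {D : Set X} (hD : Dense D) (h : ∀ x ∈ D, CauchySeq fun n => f n x) (x : X) :
    CauchySeq fun n => f n x := by
  rw [Metric.cauchySeq_iff']
  intro ε hε
  have hC : 0 < |C| + 1 := by positivity
  obtain ⟨y, hy, hxy⟩ := hD.exists_dist_lt x (div_pos (div_pos hε three_pos) hC)
  obtain ⟨N, hN⟩ := Metric.cauchySeq_iff'.1 (h y hy) (ε / 3) (by positivity)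
  refine ⟨N, fun n hn => ?_⟩
  have key : ∀ m, dist (f m x) (f m y) < ε / 3 := fun m => by
    refine (hf m x y).trans_lt (lt_of_le_of_lt ?_ ((lt_div_iff₀' hC).1 hxy))
    exact mul_le_mul_of_nonneg_right (by linarith [le_abs_self C]) dist_nonneg
  have h1 := dist_triangle4 (f n x) (f n y) (f N y) (f N x)
  have h2 := key n
  have h3 := key N
  rw [dist_comm] at h3
  linarith [hN n hn]

/-- A pointwise norm limit of `*`-homomorphisms with values in a closed `*`-subalgebra is a
`*`-homomorphism into that subalgebra. -/
theorem exists_starAlgHom_tendsto {B C : Type*} [Semiring B] [StarRing B]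
    [Algebra ℂ B] [StarModule ℂ B] [CStarAlgebra C] {S : StarSubalgebra ℂ C}
    (hS : IsClosed (S : Set C)) (f : ℕ → B →⋆ₐ[ℂ] C)
    (hf : ∀ n x, f n x ∈ S) (h : ∀ x, CauchySeq fun n => f n x) :
    ∃ g : B →⋆ₐ[ℂ] S, ∀ x, Tendsto (fun n => f n x) atTop (𝓝 (g x : C)) := by
  choose g hg using fun x => cauchySeq_tendsto_of_complete (h x)
  let g' : B →⋆ₐ[ℂ] C :=
    { toFun := g
      map_one' := tendsto_nhds_unique (hg 1) (by simp)
      map_mul' := fun x y => tendsto_nhds_unique (hg (x * y))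
        (by simpa using (hg x).mul (hg y))
      map_zero' := tendsto_nhds_unique (hg 0) (by simp)
      map_add' := fun x y => tendsto_nhds_unique (hg (x + y))
        (by simpa using (hg x).add (hg y))
      commutes' := fun r => tendsto_nhds_unique (hg _) (by simp [AlgHomClass.commutes])
      map_star' := fun x => tendsto_nhds_unique (hg (star x))
        (by simpa [map_star] using (hg x).star) }
  exact ⟨g'.codRestrict S fun x => hS.mem_of_tendsto (hg x) (Eventually.of_forall fun n => hf n x),
    hg⟩

theorem norm_apply_le_of_isClosed {C : Type*} [CStarAlgebra C] {S : StarSubalgebra ℂ C}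
    (hS : IsClosed (S : Set C)) (α : S →⋆ₐ[ℂ] S) (x : S) : ‖α x‖ ≤ ‖x‖ :=
  NonUnitalStarAlgHom.norm_apply_le α x

theorem continuous_of_isClosed {C : Type*} [CStarAlgebra C] {S : StarSubalgebra ℂ C}
    (hS : IsClosed (S : Set C)) (α : S →⋆ₐ[ℂ] S) : Continuous α :=
  starAlgHom_continuous α

theorem dense_preimage_of_eq_topologicalClosure {C : Type*} [CStarAlgebra C]
    {S S₀ : StarSubalgebra ℂ C} (hS : S = S₀.topologicalClosure) :
    Dense {x : S | (x : C) ∈ S₀} := by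
  have himg : Subtype.val '' {x : S | (x : C) ∈ S₀} = (S₀ : Set C) := by
    ext x
    exact ⟨fun ⟨y, hy, hyx⟩ => hyx ▸ hy,
      fun hx => ⟨⟨x, hS.ge (S₀.le_topologicalClosure hx)⟩, hx, rfl⟩⟩
  refine Subtype.dense_iff.2 fun x hx => ?_
  change x ∈ closure (Subtype.val '' {x : S | (x : C) ∈ S₀})
  rw [himg]
  exact hS.le hx

/-- A sequence of endomorphisms of a C⋆-algebra that is eventually constant on each element of a
dense `*`-subalgebra of `S` and preserves `S` has a pointwise limit on `S`. -/
theorem exists_starAlgHom_of_eventually_const {C : Type*} [CStarAlgebra C]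
    {S S₀ : StarSubalgebra ℂ C} (hS : S = S₀.topologicalClosure) (f : ℕ → C →⋆ₐ[ℂ] C)
    (hf : ∀ n, ∀ x ∈ S, f n x ∈ S) (h : ∀ x ∈ S₀, ∃ v, ∀ᶠ n in atTop, f n x = v) :
    ∃ g : S →⋆ₐ[ℂ] S, ∀ (x : S) (v : C), (∀ᶠ n in atTop, f n x = v) → (g x : C) = v := by
  have hcauchy : ∀ x : S, CauchySeq fun n => (f n).comp S.subtype x := by
    refine cauchySeq_of_lipschitz_of_dense (C := 1) (fun n x y => ?_)
      (dense_preimage_of_eq_topologicalClosure hS) fun x hx => ?_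
    · rw [one_mul, dist_eq_norm, dist_eq_norm, ← map_sub]
      exact NonUnitalStarAlgHom.norm_apply_le (f n) _
    · obtain ⟨v, hv⟩ := h x hx
      exact (tendsto_const_nhds.congr' (hv.mono fun _ => Eq.symm)).cauchySeq
  have hcl : IsClosed (S : Set C) := by
    rw [hS]
    exact StarSubalgebra.isClosed_topologicalClosure _
  obtain ⟨g, hg⟩ := exists_starAlgHom_tendsto hcl (fun n => (f n).comp S.subtype)
    (fun n x => hf n x x.2) hcauchy
  exact ⟨g, fun x v hv =>
    tendsto_nhds_unique (hg x) (tendsto_const_nhds.congr' (hv.mono fun _ => Eq.symm))⟩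

variable {H : Type*} [NormedAddCommGroup H] [InnerProductSpace ℂ H] [CompleteSpace H]

/-- A bounded sequence of operators all of whose matrix coefficients converge has a limit in the
weak operator topology, with the same bound. -/
theorem exists_tendsto_wot {a : ℕ → H →L[ℂ] H} {C : ℝ} (hC : ∀ n, ‖a n‖ ≤ C)
    (h : ∀ y z, CauchySeq fun n => (inner ℂ z (a n y) : ℂ)) :
    ∃ b : H →L[ℂ] H, ‖b‖ ≤ C ∧ Tendsto (fun n => ContinuousLinearMapWOT.ofCLM (a n)) atTop
      (𝓝 (ContinuousLinearMapWOT.ofCLM b)) := by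
  have h' : ∀ y z, ∃ c : ℂ, Tendsto (fun n => (inner ℂ (a n y) z : ℂ)) atTop (𝓝 c) := fun y z => by
    obtain ⟨c, hc⟩ := cauchySeq_tendsto_of_complete (h y z)
    exact ⟨star c, by simpa using hc.star⟩
  choose c hc using h'
  have hC0 : 0 ≤ C := (norm_nonneg _).trans (hC 0)
  have hbd : ∀ y z, ‖c y z‖ ≤ C * ‖y‖ * ‖z‖ := fun y z => by
    refine le_of_tendsto (hc y z).norm (Eventually.of_forall fun n => ?_)
    refine (norm_inner_le_norm _ _).trans ?_
    gcongr
    exact (a n).le_of_opNorm_le (hC n) y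
  let S : H →L⋆[ℂ] H →L[ℂ] ℂ := LinearMap.mkContinuous₂
    (LinearMap.mk₂'ₛₗ (starRingEnd ℂ) (RingHom.id ℂ) c
      (fun y y' z => tendsto_nhds_unique (hc _ _)
        (by simpa [inner_add_left] using (hc y z).add (hc y' z)))
      (fun r y z => tendsto_nhds_unique (hc _ _)
        (by simpa [inner_smul_left, mul_comm] using (hc y z).const_mul (starRingEnd ℂ r)))
      (fun y z z' => tendsto_nhds_unique (hc _ _)
        (by simpa [inner_add_right] using (hc y z).add (hc y z')))
      (fun r y z => tendsto_nhds_unique (hc _ _)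
        (by simpa [inner_smul_right] using (hc y z).const_mul r))) C hbd
  let b := InnerProductSpace.continuousLinearMapOfBilin S
  have hb : ∀ y z, inner ℂ (b y) z = c y z :=
    fun y z => InnerProductSpace.continuousLinearMapOfBilin_apply S y z
  refine ⟨b, ContinuousLinearMap.opNorm_le_of_re_inner_le hC0 fun y z hy hz => ?_, ?_⟩
  · have h1 := hbd y z
    rw [hy, hz, ← hb, mul_one, mul_one] at h1
    exact (RCLike.re_le_norm _).trans h1
  · rw [ContinuousLinearMapWOT.tendsto_iff_forall_inner_apply_tendsto]
    intro y z
    have h1 := (hc y z).star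
    rw [← hb] at h1
    simp only [RCLike.star_def, inner_conj_symm] at h1
    exact h1

omit [CompleteSpace H] in
/-- An operator is determined by its matrix coefficients with respect to a dense set of vectors. -/
theorem eq_of_inner_eq_of_dense {V : Set H} (hV : Dense V) {a b : H →L[ℂ] H}
    (h : ∀ y ∈ V, ∀ z ∈ V, (inner ℂ z (a y) : ℂ) = inner ℂ z (b y)) : a = b := by
  refine ContinuousLinearMap.coeFn_injective (a.continuous.ext_on hV b.continuous fun y hy => ?_)
  refine ext_inner_left ℂ fun z => congrFun (Continuous.ext_on hV
    (continuous_id.inner continuous_const) (continuous_id.inner continuous_const) (h y hy)) z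

/-- A sequence of linear contractions with values in `B(H)` converges pointwise in the weak operator
topology to a linear contraction, as soon as its matrix coefficients with respect to dense sets of
arguments and of vectors converge. -/
theorem exists_clm_tendsto_wot {B : Type*} [NormedAddCommGroup B] [NormedSpace ℂ B]
    {T : ℕ → B →ₗ[ℂ] (H →L[ℂ] H)} (hT : ∀ n x, ‖T n x‖ ≤ ‖x‖) {D : Set B} (hD : Dense D)
    {V : Set H} (hV : Dense V)
    (h : ∀ x ∈ D, ∀ y ∈ V, ∀ z ∈ V, CauchySeq fun n => (inner ℂ z (T n x y) : ℂ)) :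
    ∃ G : B →L[ℂ] (H →L[ℂ] H), (∀ x, ‖G x‖ ≤ ‖x‖) ∧
      ∀ x, Tendsto (fun n => ContinuousLinearMapWOT.ofCLM (T n x)) atTop
        (𝓝 (ContinuousLinearMapWOT.ofCLM (G x))) := by
  have h1 : ∀ x ∈ D, ∀ y ∈ V, ∀ z, CauchySeq fun n => (inner ℂ z (T n x y) : ℂ) := by
    intro x hx y hy
    refine cauchySeq_of_lipschitz_of_dense (C := ‖x‖ * ‖y‖) (fun n z z' => ?_) hV (h x hx y hy)
    rw [dist_eq_norm, dist_eq_norm, ← inner_sub_left, mul_comm]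
    refine (norm_inner_le_norm _ _).trans ?_
    gcongr
    exact (T n x).le_of_opNorm_le (hT n x) y
  have h2 : ∀ x ∈ D, ∀ z y, CauchySeq fun n => (inner ℂ z (T n x y) : ℂ) := by
    intro x hx z
    refine cauchySeq_of_lipschitz_of_dense (C := ‖z‖ * ‖x‖) (fun n y y' => ?_) hV
      fun y hy => h1 x hx y hy z
    rw [dist_eq_norm, dist_eq_norm, ← inner_sub_right, ← map_sub, mul_assoc]
    refine (norm_inner_le_norm _ _).trans ?_
    gcongr
    exact (T n x).le_of_opNorm_le (hT n x) _
  have h3 : ∀ z y x, CauchySeq fun n => (inner ℂ z (T n x y) : ℂ) := by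
    intro z y
    refine cauchySeq_of_lipschitz_of_dense (C := ‖z‖ * ‖y‖) (fun n x x' => ?_) hD
      fun x hx => h2 x hx z y
    rw [dist_eq_norm, dist_eq_norm, ← inner_sub_right, ← _root_.sub_apply, ← map_sub,
      mul_assoc, mul_comm ‖y‖]
    refine (norm_inner_le_norm _ _).trans ?_
    gcongr
    exact (T n (x - x')).le_of_opNorm_le (hT n _) _
  choose g hgn hg using fun x => exists_tendsto_wot (fun n => hT n x) fun y z => h3 z y x
  exact ⟨LinearMap.mkContinuous
    { toFun := g
      map_add' := fun x x' => ContinuousLinearMapWOT.ofCLM_injective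
        (tendsto_nhds_unique (hg _) (by simpa using (hg x).add (hg x')))
      map_smul' := fun r x => ContinuousLinearMapWOT.ofCLM_injective
        (tendsto_nhds_unique (hg _) (by simpa using (hg x).const_smul r)) } 1
    (by simpa using hgn), hgn, hg⟩

/-- The commutant of an operator is closed under limits of sequences in the weak operator
topology. -/
theorem commute_of_tendsto_wot {a : ℕ → H →L[ℂ] H} {b s : H →L[ℂ] H}
    (h : Tendsto (fun n => ContinuousLinearMapWOT.ofCLM (a n)) atTop
      (𝓝 (ContinuousLinearMapWOT.ofCLM b))) (hs : ∀ᶠ n in atTop, s * a n = a n * s) :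
    s * b = b * s := by
  rw [ContinuousLinearMapWOT.tendsto_iff_forall_inner_apply_tendsto] at h
  ext y
  refine ext_inner_left ℂ fun z => ?_
  have h1 := h y (star s z)
  have h2 := h (s y) z
  refine tendsto_nhds_unique_of_eventuallyEq (f := fun n => (inner ℂ z ((s * a n) y) : ℂ))
    (g := fun n => (inner ℂ z ((a n * s) y) : ℂ)) ?_ h2 (hs.mono fun n hn => by simp only [hn])
  simpa [ContinuousLinearMap.star_eq_adjoint, ContinuousLinearMap.adjoint_inner_left] using h1

/-- A von Neumann algebra of the form `W*(S)` is closed under limits of sequences in the weak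
operator topology. -/
theorem mem_vonNeumannGenerated_of_tendsto_wot {S : Set (H →L[ℂ] H)} {a : ℕ → H →L[ℂ] H}
    {b : H →L[ℂ] H}
    (h : Tendsto (fun n => ContinuousLinearMapWOT.ofCLM (a n)) atTop
      (𝓝 (ContinuousLinearMapWOT.ofCLM b)))
    (ha : ∀ᶠ n in atTop, a n ∈ (vonNeumannGenerated S).toStarSubalgebra) :
    b ∈ (vonNeumannGenerated S).toStarSubalgebra := by
  refine (StarSubalgebra.mem_centralizer_iff ℂ).2 fun s hs => ⟨?_, ?_⟩
  · exact commute_of_tendsto_wot h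
      (ha.mono fun n hn => ((StarSubalgebra.mem_centralizer_iff ℂ).1 hn s hs).1)
  · exact commute_of_tendsto_wot h
      (ha.mono fun n hn => ((StarSubalgebra.mem_centralizer_iff ℂ).1 hn s hs).2)

theorem vonNeumannGenerated_mono {S S' : Set (H →L[ℂ] H)} (h : S ⊆ S') :
    (vonNeumannGenerated S).toStarSubalgebra ≤ (vonNeumannGenerated S').toStarSubalgebra :=
  StarSubalgebra.centralizer_le ℂ _ _ (StarSubalgebra.centralizer_le ℂ _ _ h)

/-- A contractive map onto `D` that is the identity on `D` is a conditional expectation. -/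
theorem isConditionalExpectation_of_contractive [Nontrivial H]
    {B D : StarSubalgebra ℂ (H →L[ℂ] H)} {E : B →L[ℂ] (H →L[ℂ] H)} (hle : D ≤ B)
    (hmem : ∀ x, E x ∈ D) (hid : ∀ x : B, (x : H →L[ℂ] H) ∈ D → E x = x)
    (hnorm : ∀ x, ‖E x‖ ≤ ‖x‖) : IsConditionalExpectation B D E where
  le := hle
  mem := hmem
  apply_of_mem := hid
  norm_eq_one := by
    refine le_antisymm (E.opNorm_le_bound zero_le_one (by simpa using hnorm)) ?_
    have h1 : E 1 = 1 := hid 1 (one_mem D)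
    have h2 := E.le_opNorm 1
    have h3 : ‖(1 : B)‖ = 1 := norm_one (α := H →L[ℂ] H)
    rwa [h1, h3, mul_one, norm_one] at h2

theorem isConditionalExpectation_restrictTo [Nontrivial H]
    {B C D : StarSubalgebra ℂ (H →L[ℂ] H)} (h : B ≤ C) {E : C →L[ℂ] (H →L[ℂ] H)} (hle : D ≤ B)
    (hmem : ∀ x : C, (x : H →L[ℂ] H) ∈ B → E x ∈ D)
    (hid : ∀ x : C, (x : H →L[ℂ] H) ∈ D → E x = x) (hnorm : ∀ x, ‖E x‖ ≤ ‖x‖) :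
    IsConditionalExpectation B D (restrictTo h E) :=
  isConditionalExpectation_of_contractive hle
    (fun x => hmem (StarSubalgebra.inclusion h x) x.2)
    (fun x hx => hid (StarSubalgebra.inclusion h x) hx)
    (fun x => hnorm (StarSubalgebra.inclusion h x))

end Limits

end SymState

namespace SymState

/-! ### Finitary permutations and elements depending on finitely many indices -/

section Finitary

theorem IsFinitary.one : IsFinitary 1 := by simp [IsFinitary]

theorem IsFinitary.mul {σ τ : Equiv.Perm ℕ} (hσ : IsFinitary σ) (hτ : IsFinitary τ) :
    IsFinitary (σ * τ) := by
  refine (hσ.union hτ).subset fun i hi => ?_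
  by_contra h
  simp only [Set.mem_union, Set.mem_ofPred_eq, not_or, not_not] at h
  exact hi (by rw [Equiv.Perm.mul_apply, h.2, h.1])

theorem IsFinitary.exists_bound {σ : Equiv.Perm ℕ} (hσ : IsFinitary σ) :
    ∃ K, ∀ i, K ≤ i → σ i = i := by
  obtain ⟨K, hK⟩ := Set.Finite.bddAbove hσ
  refine ⟨K + 1, fun i hi => ?_⟩
  by_contra h
  have := hK h
  omega

/-- Every injection of a finite set of indices extends to a finitary permutation. -/
theorem exists_finitary_eqOn (s : Finset ℕ) {f : ℕ → ℕ} (hf : Set.InjOn f s) :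
    ∃ σ : Equiv.Perm ℕ, IsFinitary σ ∧ ∀ i ∈ s, σ i = f i := by
  classical
  let t : Finset ℕ := s ∪ s.image f
  obtain ⟨g, hg⟩ := Set.MapsTo.exists_equiv_extend_of_card_eq (α := t) (t := t)
    (Fintype.card_coe t) (s := {i : t | (i : ℕ) ∈ s}) (f := fun i => f i)
    (fun i hi => Finset.mem_union_right _ (Finset.mem_image_of_mem f hi))
    (fun i hi j hj hij => Subtype.ext (hf hi hj hij))
  refine ⟨Equiv.Perm.ofSubtype (p := (· ∈ t)) g, t.finite_toSet.subset fun i hi => ?_,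
    fun i hi => ?_⟩
  · by_contra h
    exact hi (Equiv.Perm.ofSubtype_apply_of_not_mem (p := (· ∈ t)) g h)
  · have hit : i ∈ t := Finset.mem_union_left _ hi
    rw [Equiv.Perm.ofSubtype_apply_of_mem (p := (· ∈ t)) g hit]
    exact hg ⟨i, hit⟩ hi

theorem exists_finitary_add (N n : ℕ) :
    ∃ σ : Equiv.Perm ℕ, IsFinitary σ ∧ ∀ i < N, σ i = i + n := by
  obtain ⟨σ, hσ, h⟩ := exists_finitary_eqOn (Finset.range N) (f := (· + n))
    (add_left_injective n).injOn
  exact ⟨σ, hσ, fun i hi => h i (Finset.mem_range.2 hi)⟩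

variable {B C : Type*} [Semiring B] [StarRing B] [Algebra ℂ B] [StarModule ℂ B]
  [Semiring C] [StarRing C] [Algebra ℂ C]

/-- For a family `Φ` of `*`-homomorphisms indexed by permutations, the elements `x` that depend on
the first `N` indices only: on the finitary permutations `σ`, the value `Φ σ x` depends only on the
restriction of `σ` to `{0, …, N - 1}`. -/
def localElements (Φ : Equiv.Perm ℕ → B →⋆ₐ[ℂ] C) (N : ℕ) : StarSubalgebra ℂ B where
  carrier := {x | ∀ σ τ : Equiv.Perm ℕ, IsFinitary σ → IsFinitary τ → (∀ i < N, σ i = τ i) →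
    Φ σ x = Φ τ x}
  mul_mem' hx hy σ τ hσ hτ h := by rw [map_mul, map_mul, hx σ τ hσ hτ h, hy σ τ hσ hτ h]
  add_mem' hx hy σ τ hσ hτ h := by rw [map_add, map_add, hx σ τ hσ hτ h, hy σ τ hσ hτ h]
  algebraMap_mem' r σ τ _ _ _ := by rw [AlgHomClass.commutes, AlgHomClass.commutes]
  star_mem' hx σ τ hσ hτ h := by rw [map_star, map_star, hx σ τ hσ hτ h]

theorem localElements_mono (Φ : Equiv.Perm ℕ → B →⋆ₐ[ℂ] C) {N N' : ℕ} (h : N ≤ N') :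
    localElements Φ N ≤ localElements Φ N' :=
  fun _ hx σ τ hσ hτ hστ => hx σ τ hσ hτ fun i hi => hστ i (hi.trans_le h)

theorem exists_mem_localElements_of_mem_adjoin {Φ : Equiv.Perm ℕ → B →⋆ₐ[ℂ] C} {S : Set B}
    (hS : ∀ x ∈ S, ∃ N, x ∈ localElements Φ N) {x : B} (hx : x ∈ StarAlgebra.adjoin ℂ S) :
    ∃ N, x ∈ localElements Φ N := by
  induction hx using StarAlgebra.adjoin_induction with
  | mem x hx => exact hS x hx
  | algebraMap r => exact ⟨0, algebraMap_mem _ r⟩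
  | add x y _ _ hx hy =>
    obtain ⟨N, hN⟩ := hx
    obtain ⟨N', hN'⟩ := hy
    exact ⟨max N N', add_mem (localElements_mono Φ (le_max_left _ _) hN)
      (localElements_mono Φ (le_max_right _ _) hN')⟩
  | mul x y _ _ hx hy =>
    obtain ⟨N, hN⟩ := hx
    obtain ⟨N', hN'⟩ := hy
    exact ⟨max N N', mul_mem (localElements_mono Φ (le_max_left _ _) hN)
      (localElements_mono Φ (le_max_right _ _) hN')⟩
  | star x _ hx => exact hx.imp fun N hN => star_mem hN

end Finitary

/-! ### Generators of the algebras `𝓡_ψ` and `𝓠_ψ` -/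

section Generators

theorem adjoin_union_image_adjoin {B C : Type*} [Semiring B] [StarRing B] [Algebra ℂ B]
    [StarModule ℂ B] [Semiring C] [StarRing C] [Algebra ℂ C] [StarModule ℂ C]
    (f : B →⋆ₐ[ℂ] C) (F : Set C) (L : Set B) :
    StarAlgebra.adjoin ℂ (F ∪ f '' (StarAlgebra.adjoin ℂ L)) =
      StarAlgebra.adjoin ℂ (F ∪ f '' L) := by
  refine le_antisymm (StarAlgebra.adjoin_le (Set.union_subset ?_ ?_)) (StarAlgebra.adjoin_mono
    (Set.union_subset_union_right _ (Set.image_mono (StarAlgebra.subset_adjoin ℂ L))))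
  · exact Set.subset_union_left.trans (StarAlgebra.subset_adjoin ℂ _)
  · have h : (StarAlgebra.adjoin ℂ L).map f ≤ StarAlgebra.adjoin ℂ (F ∪ f '' L) := by
      rw [StarAlgHom.map_adjoin]
      exact StarAlgebra.adjoin_mono Set.subset_union_right
    exact h

/-- A closed `*`-subalgebra of a closed `*`-subalgebra `R` that contains a set `T` also contains
the elements of the closed `*`-algebra generated by `T`. -/
theorem mem_of_mem_adjoin_closure {B : Type*} [CStarAlgebra B] {R : StarSubalgebra ℂ B}
    (hR : IsClosed (R : Set B)) {S : StarSubalgebra ℂ R} (hS : IsClosed (S : Set R)) {T : Set B}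
    (hT : ∀ x ∈ T, ∃ h : x ∈ R, (⟨x, h⟩ : R) ∈ S) (x : R)
    (hx : (x : B) ∈ (StarAlgebra.adjoin ℂ T).topologicalClosure) : x ∈ S := by
  have h1 : StarAlgebra.adjoin ℂ T ≤ S.map R.subtype := StarAlgebra.adjoin_le fun y hy => by
    obtain ⟨h, hyS⟩ := hT y hy
    exact ⟨⟨y, h⟩, hyS, rfl⟩
  have h2 : IsClosed (S.map R.subtype : Set B) :=
    hR.isClosedEmbedding_subtypeVal.isClosedMap _ hS
  obtain ⟨y, hy, hyx⟩ := StarSubalgebra.topologicalClosure_minimal h1 h2 hx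
  rwa [← Subtype.ext hyx]

namespace SymmetricState

variable {A : Type u} [CStarAlgebra A] (ψ : SymmetricState A)

/-- The `*`-algebra generated by `𝓕_ψ` and the operators `πᵢ(a)`, dense in `𝓡_ψ`. -/
noncomputable def algR : StarSubalgebra ℂ (ψ.H →L[ℂ] ψ.H) :=
  StarAlgebra.adjoin ℂ ((ψ.fixed : Set (ψ.H →L[ℂ] ψ.H)) ∪ ⋃ i, Set.range (ψ.rep i))

theorem gns_image_iUnion_range_lam :
    ψ.gns '' (⋃ i, Set.range (lam (A := A) i)) = ⋃ i, Set.range (ψ.rep i) := by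
  rw [Set.image_iUnion]
  refine Set.iUnion_congr fun i => ?_
  rw [← Set.range_comp]
  rfl

theorem R_eq : ψ.R = ψ.algR.topologicalClosure := by
  rw [R, algFreeProd, adjoin_union_image_adjoin, gns_image_iUnion_range_lam, algR]

theorem Q_eq : ψ.Q = (StarAlgebra.adjoin ℂ
    ((ψ.tail : Set (ψ.H →L[ℂ] ψ.H)) ∪ ⋃ i, Set.range (ψ.rep i))).topologicalClosure := by
  rw [Q, algFreeProd, adjoin_union_image_adjoin, gns_image_iUnion_range_lam]

theorem isClosed_R : IsClosed (ψ.R : Set (ψ.H →L[ℂ] ψ.H)) :=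
  StarSubalgebra.isClosed_topologicalClosure _

theorem fixed_le_R : ψ.fixed ≤ ψ.R := by
  rw [R_eq]
  exact fun x hx => StarSubalgebra.le_topologicalClosure _
    (StarAlgebra.subset_adjoin ℂ _ (Or.inl hx))

theorem dense_algR : Dense {x : ψ.R | (x : ψ.H →L[ℂ] ψ.H) ∈ ψ.algR} :=
  dense_preimage_of_eq_topologicalClosure ψ.R_eq

/-! ### The action of the permutations on operators -/

theorem U_U (σ τ : Equiv.Perm ℕ) (y : ψ.H) : ψ.U σ (ψ.U τ y) = ψ.U (σ * τ) y := by
  refine congrFun (ψ.denseRange_hat.equalizer ((ψ.U σ).continuous.comp (ψ.U τ).continuous)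
    (ψ.U (σ * τ)).continuous (funext fun a => ?_)) y
  simp only [Function.comp_apply, U_hat, beta_beta]

theorem betaHat_apply (σ : Equiv.Perm ℕ) (x : ψ.H →L[ℂ] ψ.H) (y : ψ.H) :
    ψ.betaHat σ x y = ψ.U σ (x ((ψ.U σ).symm y)) := rfl

/-- The equation `β̂_σ(x) = z` as an intertwining relation for `U_σ`. -/
theorem betaHat_eq_iff (σ : Equiv.Perm ℕ) (x z : ψ.H →L[ℂ] ψ.H) :
    ψ.betaHat σ x = z ↔
      ((ψ.U σ).toContinuousLinearEquiv : ψ.H →L[ℂ] ψ.H) * x =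
        z * ((ψ.U σ).toContinuousLinearEquiv : ψ.H →L[ℂ] ψ.H) := by
  constructor
  · rintro rfl
    ext y
    simp [betaHat]
  · intro h
    ext y
    have := DFunLike.congr_fun h ((ψ.U σ).symm y)
    simpa [betaHat] using this

theorem betaHat_betaHat (σ τ : Equiv.Perm ℕ) (x : ψ.H →L[ℂ] ψ.H) :
    ψ.betaHat σ (ψ.betaHat τ x) = ψ.betaHat (σ * τ) x := by
  symm
  rw [betaHat_eq_iff]
  ext y
  change ψ.U (σ * τ) (x y) = ψ.betaHat σ (ψ.betaHat τ x) (ψ.U (σ * τ) y)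
  rw [← U_U, ← U_U, betaHat_apply, betaHat_apply, LinearIsometryEquiv.symm_apply_apply,
    LinearIsometryEquiv.symm_apply_apply]

theorem betaHat_one (x : ψ.H →L[ℂ] ψ.H) : ψ.betaHat 1 x = x := by
  have h : ∀ y, ψ.U 1 y = y := fun y => by
    refine congrFun (ψ.denseRange_hat.equalizer (ψ.U 1).continuous continuous_id
      (funext fun a => ?_)) y
    simp only [Function.comp_apply, U_hat, beta_one, id]
  rw [betaHat_eq_iff]
  ext y
  simp [h]

theorem betaHat_gns (σ : Equiv.Perm ℕ) (a : FreeProd A) :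
    ψ.betaHat σ (ψ.gns a) = ψ.gns (beta σ a) := by
  rw [betaHat_eq_iff]
  ext y
  refine congrFun (ψ.denseRange_hat.equalizer
    ((ψ.U σ).continuous.comp (ψ.gns a).continuous)
    ((ψ.gns (beta σ a)).continuous.comp (ψ.U σ).continuous) (funext fun b => ?_)) y
  simp only [Function.comp_apply, U_hat, gns_hat, map_mul]

theorem betaHat_rep (σ : Equiv.Perm ℕ) (i : ℕ) (a : A) :
    ψ.betaHat σ (ψ.rep i a) = ψ.rep (σ i) a :=
  (ψ.betaHat_gns σ _).trans (congrArg ψ.gns (beta_lam σ i a))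

/-- The automorphism `β̂_σ` as a `*`-homomorphism. -/
noncomputable def betaHom (σ : Equiv.Perm ℕ) : (ψ.H →L[ℂ] ψ.H) →⋆ₐ[ℂ] (ψ.H →L[ℂ] ψ.H) where
  toFun := ψ.betaHat σ
  map_one' := _root_.map_one (ψ.betaHat σ)
  map_mul' := map_mul _
  map_zero' := map_zero _
  map_add' := map_add _
  commutes' := AlgHomClass.commutes (ψ.betaHat σ)
  map_star' := conj_star (ψ.U σ)

theorem continuous_betaHat (σ : Equiv.Perm ℕ) : Continuous (ψ.betaHat σ) :=
  starAlgHom_continuous (ψ.betaHom σ)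

theorem betaHom_apply (σ : Equiv.Perm ℕ) (x : ψ.H →L[ℂ] ψ.H) :
    ψ.betaHom σ x = ψ.betaHat σ x := rfl

theorem betaHat_mem_R {σ : Equiv.Perm ℕ} (hσ : IsFinitary σ) {x : ψ.H →L[ℂ] ψ.H}
    (hx : x ∈ ψ.R) : ψ.betaHat σ x ∈ ψ.R := by
  have h : ψ.algR ≤ ψ.R.comap (ψ.betaHom σ) := by
    refine StarAlgebra.adjoin_le (Set.union_subset (fun y hy => ?_) (Set.iUnion_subset fun i => ?_))
    · rw [SetLike.mem_coe, StarSubalgebra.mem_comap, betaHom_apply, hy.2 σ hσ]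
      exact ψ.fixed_le_R hy
    · rintro _ ⟨a, rfl⟩
      rw [SetLike.mem_coe, StarSubalgebra.mem_comap, betaHom_apply, betaHat_rep]
      exact ψ.rep_mem_R _ _
  have hcl : IsClosed {x | ψ.betaHat σ x ∈ ψ.R} := ψ.isClosed_R.preimage (ψ.continuous_betaHat σ)
  have hsub : (ψ.algR : Set (ψ.H →L[ℂ] ψ.H)) ⊆ {x | ψ.betaHat σ x ∈ ψ.R} := fun y hy =>
    (StarSubalgebra.mem_comap _ _ _).1 (h hy)
  rw [R_eq] at hx
  exact closure_minimal hsub hcl hx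

/-! ### Local operators and local vectors -/

/-- The operators `x` for which `β̂_σ(x)` depends only on the restriction of `σ` to
`{0, …, N - 1}`. -/
noncomputable abbrev localOps (N : ℕ) : StarSubalgebra ℂ (ψ.H →L[ℂ] ψ.H) :=
  localElements ψ.betaHom N

variable {ψ}

theorem betaHat_eq_of_mem_localOps {N : ℕ} {x : ψ.H →L[ℂ] ψ.H} (hx : x ∈ ψ.localOps N)
    {σ τ : Equiv.Perm ℕ} (hσ : IsFinitary σ) (hτ : IsFinitary τ) (h : ∀ i < N, σ i = τ i) :
    ψ.betaHat σ x = ψ.betaHat τ x :=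
  hx σ τ hσ hτ h

theorem fixed_le_localOps (N : ℕ) : ψ.fixed ≤ ψ.localOps N :=
  fun _ hx σ τ hσ hτ _ => (hx.2 σ hσ).trans (hx.2 τ hτ).symm

theorem rep_mem_localOps (i : ℕ) (a : A) : ψ.rep i a ∈ ψ.localOps (i + 1) :=
  fun σ τ _ _ h => ((ψ.betaHat_rep σ i a).trans (by rw [h i (Nat.lt_succ_self i)])).trans
    (ψ.betaHat_rep τ i a).symm

theorem exists_mem_localOps {x : ψ.H →L[ℂ] ψ.H} (hx : x ∈ ψ.algR) : ∃ N, x ∈ ψ.localOps N := by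
  refine exists_mem_localElements_of_mem_adjoin (fun y hy => ?_) hx
  rcases hy with hy | hy
  · exact ⟨0, fixed_le_localOps 0 hy⟩
  · obtain ⟨i, a, rfl⟩ := Set.mem_iUnion.1 hy
    exact ⟨i + 1, rep_mem_localOps i a⟩

theorem betaHat_mem_localOps {N N' : ℕ} {x : ψ.H →L[ℂ] ψ.H} (hx : x ∈ ψ.localOps N)
    {ρ : Equiv.Perm ℕ} (hρ : IsFinitary ρ) (h : ∀ i < N, ρ i < N') :
    ψ.betaHat ρ x ∈ ψ.localOps N' := by
  intro σ τ hσ hτ hστ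
  change ψ.betaHat σ (ψ.betaHat ρ x) = ψ.betaHat τ (ψ.betaHat ρ x)
  rw [betaHat_betaHat, betaHat_betaHat]
  exact betaHat_eq_of_mem_localOps hx (hσ.mul hρ) (hτ.mul hρ) fun i hi => hστ _ (h i hi)

variable (ψ) in
/-- The vectors fixed by `U_σ` for all finitary `σ` that fix each of `0, …, K - 1`. -/
def localVectors (K : ℕ) : Set ψ.H :=
  {y | ∀ σ : Equiv.Perm ℕ, IsFinitary σ → (∀ i < K, σ i = i) → ψ.U σ y = y}

theorem localVectors_mono {K K' : ℕ} (h : K ≤ K') : ψ.localVectors K ⊆ ψ.localVectors K' :=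
  fun _ hy σ hσ hK => hy σ hσ fun i hi => hK i (hi.trans_le h)

theorem hat_one_mem_localVectors (K : ℕ) : ψ.hat 1 ∈ ψ.localVectors K :=
  fun σ _ _ => by rw [U_hat, _root_.map_one]

/-- A word in finitely many copies of `A` gives a local vector. -/
theorem exists_hat_mem_localVectors {a : FreeProd A} (ha : a ∈ algFreeProd A) :
    ∃ K, ψ.hat a ∈ ψ.localVectors K := by
  have h : ∃ K, a ∈ localElements (beta (A := A)) K := by
    refine exists_mem_localElements_of_mem_adjoin (fun y hy => ?_) ha
    obtain ⟨i, b, rfl⟩ := Set.mem_iUnion.1 hy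
    exact ⟨i + 1, fun σ τ _ _ h => by rw [beta_lam, beta_lam, h i (Nat.lt_succ_self i)]⟩
  obtain ⟨K, hK⟩ := h
  refine ⟨K, fun σ hσ h => ?_⟩
  rw [U_hat, hK σ 1 hσ IsFinitary.one h, beta_one]

variable (ψ) in
theorem dense_iUnion_localVectors : Dense (⋃ K, ψ.localVectors K) := by
  have hcont : Continuous ψ.hat := by
    have h : ψ.hat = fun a => ψ.gns a (ψ.hat 1) := by
      funext a
      rw [gns_hat, mul_one]
    rw [h]
    exact (starAlgHom_continuous ψ.gns).clm_apply continuous_const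
  have hd : Dense (algFreeProd A : Set (FreeProd A)) := fun x => by
    have : x ∈ (algFreeProd A).topologicalClosure := by rw [algFreeProd_dense]; trivial
    exact this
  refine (ψ.denseRange_hat.dense_image hcont hd).mono ?_
  rintro _ ⟨a, ha, rfl⟩
  exact Set.mem_iUnion.2 (exists_hat_mem_localVectors ha)

/-- The asymptotic invariance behind all limits: once the indices of `x` are moved beyond those of
the vectors `y` and `z`, the matrix coefficient no longer depends on where they are moved to,
because a finitary permutation fixing the indices of `y` and `z` carries one position to the
other. -/
theorem inner_betaHat_eq {N K : ℕ} {x : ψ.H →L[ℂ] ψ.H} (hx : x ∈ ψ.localOps N) {y z : ψ.H}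
    (hy : y ∈ ψ.localVectors K) (hz : z ∈ ψ.localVectors K) {ρ ρ' : Equiv.Perm ℕ}
    (hρ : IsFinitary ρ) (hρ' : IsFinitary ρ') (h : ∀ i < N, K ≤ ρ i) (h' : ∀ i < N, K ≤ ρ' i) :
    (inner ℂ z (ψ.betaHat ρ x y) : ℂ) = inner ℂ z (ψ.betaHat ρ' x y) := by
  classical
  -- `σ` is the identity on `{0, …, K - 1}` and sends `ρ i` to `ρ' i` for `i < N`.
  obtain ⟨σ, hσ, hσeq⟩ := exists_finitary_eqOn (Finset.range K ∪ (Finset.range N).image ρ)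
    (f := fun j => if j < K then j else ρ' (ρ.symm j)) (by
      intro i hi j hj hij
      have key : ∀ k, k ∈ Finset.range K ∪ (Finset.range N).image ρ → ¬ k < K →
          K ≤ ρ' (ρ.symm k) := fun k hk hkK => by
        rcases Finset.mem_union.1 hk with hk | hk
        · exact absurd (Finset.mem_range.1 hk) hkK
        · obtain ⟨m, hm, rfl⟩ := Finset.mem_image.1 hk
          rw [Equiv.symm_apply_apply]
          exact h' m (Finset.mem_range.1 hm)
      have hi' := key i hi
      have hj' := key j hj
      dsimp only at hij
      split_ifs at hij with h1 h2 h2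
      · exact hij
      · have := hj' h2
        omega
      · have := hi' h1
        omega
      · exact ρ.symm.injective (ρ'.injective hij))
  have hfix : ∀ i < K, σ i = i := fun i hi => by
    rw [hσeq i (Finset.mem_union_left _ (Finset.mem_range.2 hi)), if_pos hi]
  have hmul : ∀ i < N, (σ * ρ) i = ρ' i := fun i hi => by
    rw [Equiv.Perm.mul_apply, hσeq _ (Finset.mem_union_right _
      (Finset.mem_image_of_mem _ (Finset.mem_range.2 hi))), if_neg (not_lt.2 (h i hi)),
      Equiv.symm_apply_apply]
  rw [← betaHat_eq_of_mem_localOps hx (hσ.mul hρ) hρ' hmul, ← betaHat_betaHat]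
  have hUy : (ψ.U σ).symm y = y := by
    rw [LinearIsometryEquiv.symm_apply_eq, hy σ hσ hfix]
  conv_rhs => rw [← hz σ hσ hfix]
  change _ = inner ℂ (ψ.U σ z) (ψ.U σ (ψ.betaHat ρ x ((ψ.U σ).symm y)))
  rw [hUy, LinearIsometryEquiv.inner_map_map]

end SymmetricState

end Generators

end SymState

namespace SymState

namespace SymmetricState

open Filter Topology

variable {A : Type u} [CStarAlgebra A] (ψ : SymmetricState A)

/-! ### The shift -/

/-- The shift is the pointwise norm limit of the automorphisms `β̂_σ` for finitary permutations `σ`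
agreeing with `i ↦ i + 1` on longer and longer initial segments: on a local element this sequence
is eventually constant. -/
theorem exists_shift : ∃ α : ψ.R →⋆ₐ[ℂ] ψ.R, ψ.IsShift α ∧ ∀ (x : ψ.R) (N : ℕ),
    (x : ψ.H →L[ℂ] ψ.H) ∈ ψ.localOps N → ∀ σ : Equiv.Perm ℕ, IsFinitary σ →
      (∀ i < N, σ i = i + 1) → (α x : ψ.H →L[ℂ] ψ.H) = ψ.betaHat σ x := by
  choose c hc hceq using fun N => exists_finitary_add N 1
  have hconst : ∀ (x : ψ.H →L[ℂ] ψ.H) (N : ℕ), x ∈ ψ.localOps N → ∀ σ : Equiv.Perm ℕ,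
      IsFinitary σ → (∀ i < N, σ i = i + 1) →
      ∀ᶠ n in atTop, ψ.betaHom (c n) x = ψ.betaHat σ x := fun x N hx σ hσ hσeq => by
    filter_upwards [eventually_ge_atTop N] with n hn
    exact betaHat_eq_of_mem_localOps hx (hc n) hσ
      fun i hi => (hceq n i (hi.trans_le hn)).trans (hσeq i hi).symm
  obtain ⟨α, hlim⟩ := exists_starAlgHom_of_eventually_const ψ.R_eq (fun n => ψ.betaHom (c n))
    (fun n x hx => ψ.betaHat_mem_R (hc n) hx) fun x hx => by
      obtain ⟨N, hN⟩ := exists_mem_localOps hx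
      exact ⟨_, hconst x N hN (c N) (hc N) (hceq N)⟩
  have hα : ∀ (x : ψ.R) (N : ℕ), (x : ψ.H →L[ℂ] ψ.H) ∈ ψ.localOps N → ∀ σ : Equiv.Perm ℕ,
      IsFinitary σ → (∀ i < N, σ i = i + 1) → (α x : ψ.H →L[ℂ] ψ.H) = ψ.betaHat σ x :=
    fun x N hx σ hσ hσeq => hlim x _ (hconst x N hx σ hσ hσeq)
  refine ⟨α, ⟨fun i a => Subtype.ext ?_, fun x hx => Subtype.ext ?_⟩, hα⟩
  · rw [hα ⟨ψ.rep i a, ψ.rep_mem_R i a⟩ (i + 1) (rep_mem_localOps i a) (c (i + 1)) (hc _)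
      (hceq _), betaHat_rep, hceq _ i (Nat.lt_succ_self i)]
  · rw [hα x 0 (fixed_le_localOps 0 hx) 1 IsFinitary.one
      (fun i hi => absurd hi (Nat.not_lt_zero i)), betaHat_one]

variable {ψ} {α : ψ.R →⋆ₐ[ℂ] ψ.R}

theorem continuous_endomorphism (α : ψ.R →⋆ₐ[ℂ] ψ.R) : Continuous α :=
  continuous_of_isClosed ψ.isClosed_R α

theorem norm_iterate_le (α : ψ.R →⋆ₐ[ℂ] ψ.R) (n : ℕ) (x : ψ.R) : ‖α^[n] x‖ ≤ ‖x‖ := by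
  induction n generalizing x with
  | zero => exact le_rfl
  | succ n ih => exact (ih (α x)).trans (norm_apply_le_of_isClosed ψ.isClosed_R α x)

theorem continuous_coe_iterate (α : ψ.R →⋆ₐ[ℂ] ψ.R) (n : ℕ) :
    Continuous fun x => (α^[n] x : ψ.H →L[ℂ] ψ.H) :=
  continuous_subtype_val.comp ((continuous_endomorphism α).iterate n)

/-- The shift is unique, since a `*`-endomorphism of `𝓡_ψ` is continuous. -/
theorem IsShift.eq (hα : ψ.IsShift α) {α' : ψ.R →⋆ₐ[ℂ] ψ.R} (hα' : ψ.IsShift α') : α' = α := by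
  have hcl : IsClosed (StarAlgHom.equalizer α' α : Set ψ.R) :=
    isClosed_eq (continuous_endomorphism α') (continuous_endomorphism α)
  refine StarAlgHom.ext fun x => mem_of_mem_adjoin_closure ψ.isClosed_R hcl (fun y hy => ?_) x
    (ψ.R_eq.le x.2)
  rcases hy with hy | hy
  · exact ⟨ψ.fixed_le_R hy, (hα'.map_fixed _ hy).trans (hα.map_fixed _ hy).symm⟩
  · obtain ⟨i, a, rfl⟩ := Set.mem_iUnion.1 hy
    exact ⟨ψ.rep_mem_R i a, (hα'.map_rep i a).trans (hα.map_rep i a).symm⟩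

theorem IsShift.iterate_rep (hα : ψ.IsShift α) (n i : ℕ) (a : A) :
    α^[n] ⟨ψ.rep i a, ψ.rep_mem_R i a⟩ = ⟨ψ.rep (i + n) a, ψ.rep_mem_R _ a⟩ := by
  induction n generalizing i with
  | zero => rfl
  | succ n ih =>
    rw [Function.iterate_succ_apply, hα.map_rep, ih]
    simp only [Nat.add_assoc, Nat.add_comm 1 n]

theorem IsShift.iterate_fixed (hα : ψ.IsShift α) (n : ℕ) {x : ψ.R}
    (hx : (x : ψ.H →L[ℂ] ψ.H) ∈ ψ.fixed) : α^[n] x = x :=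
  Function.iterate_fixed (hα.map_fixed x hx) n

theorem IsShift.coe_apply (hα : ψ.IsShift α) {x : ψ.R} {N : ℕ}
    (hx : (x : ψ.H →L[ℂ] ψ.H) ∈ ψ.localOps N) {σ : Equiv.Perm ℕ} (hσ : IsFinitary σ)
    (h : ∀ i < N, σ i = i + 1) : (α x : ψ.H →L[ℂ] ψ.H) = ψ.betaHat σ x := by
  obtain ⟨α', hα', h'⟩ := ψ.exists_shift
  rw [← hα.eq hα']
  exact h' x N hx σ hσ h

/-- On local elements, the powers of the shift are given by finitary permutations. -/
theorem IsShift.coe_iterate (hα : ψ.IsShift α) (n : ℕ) {x : ψ.R} {N : ℕ}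
    (hx : (x : ψ.H →L[ℂ] ψ.H) ∈ ψ.localOps N) {σ : Equiv.Perm ℕ}
    (hσ : IsFinitary σ) (h : ∀ i < N, σ i = i + n) :
    (α^[n] x : ψ.H →L[ℂ] ψ.H) = ψ.betaHat σ x := by
  induction n generalizing x N σ with
  | zero =>
    rw [betaHat_eq_of_mem_localOps hx hσ IsFinitary.one fun i hi => h i hi, betaHat_one]
    rfl
  | succ n ih =>
    obtain ⟨c, hc, hceq⟩ := exists_finitary_add N 1
    obtain ⟨τ, hτ, hτeq⟩ := exists_finitary_add (N + 1) n
    have hαx := hα.coe_apply hx hc hceq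
    have hloc : (α x : ψ.H →L[ℂ] ψ.H) ∈ ψ.localOps (N + 1) := by
      rw [hαx]
      exact betaHat_mem_localOps hx hc fun i hi => by rw [hceq i hi]; omega
    rw [Function.iterate_succ_apply, ih hloc hτ hτeq, hαx, betaHat_betaHat]
    refine betaHat_eq_of_mem_localOps hx (hτ.mul hc) hσ fun i hi => ?_
    rw [Equiv.Perm.mul_apply, hceq i hi, hτeq _ (by omega), h i hi]
    omega

/-! ### The limit of the powers of the shift -/

theorem coe_pow_endomorphism (α : ψ.R →⋆ₐ[ℂ] ψ.R) (n : ℕ) : ⇑(α ^ n) = α^[n] :=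
  hom_coe_pow _ rfl (fun _ _ => rfl) α n

/-- The `n`-th power of an endomorphism of `𝓡_ψ`, as a linear map into the bounded operators. -/
noncomputable def iterateLinear (α : ψ.R →⋆ₐ[ℂ] ψ.R) (n : ℕ) : ψ.R →ₗ[ℂ] (ψ.H →L[ℂ] ψ.H) where
  toFun x := (α^[n] x : ψ.R)
  map_add' x y := by rw [iterate_map_add]; rfl
  map_smul' r x := by rw [← coe_pow_endomorphism, map_smul]; rfl

/-- The matrix coefficients of `αⁿ(x)` at local vectors are eventually constant for local `x`, so the
powers of the shift converge in the weak operator topology on `𝓡_ψ`. -/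
theorem IsShift.exists_limit (hα : ψ.IsShift α) :
    ∃ G : ψ.R →L[ℂ] (ψ.H →L[ℂ] ψ.H), (∀ x, ‖G x‖ ≤ ‖x‖) ∧ ∀ x : ψ.R, Tendsto
      (fun n : ℕ => ContinuousLinearMapWOT.ofCLM ((α^[n] x : ψ.R) : ψ.H →L[ℂ] ψ.H)) atTop
      (𝓝 (ContinuousLinearMapWOT.ofCLM (G x))) := by
  refine exists_clm_tendsto_wot (T := iterateLinear α) (norm_iterate_le α) ψ.dense_algR
    ψ.dense_iUnion_localVectors fun x hx y hy z hz => ?_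
  obtain ⟨N, hN⟩ := exists_mem_localOps hx
  obtain ⟨K₁, hy⟩ := Set.mem_iUnion.1 hy
  obtain ⟨K₂, hz⟩ := Set.mem_iUnion.1 hz
  have hy' := localVectors_mono (le_max_left K₁ K₂) hy
  have hz' := localVectors_mono (le_max_right K₁ K₂) hz
  choose c hc hceq using exists_finitary_add N
  have hconst : (fun n => (inner ℂ z (iterateLinear α n x y) : ℂ)) =ᶠ[atTop]
      fun _ => inner ℂ z (ψ.betaHat (c (max K₁ K₂)) x y) := by
    filter_upwards [eventually_ge_atTop (max K₁ K₂)] with n hn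
    change inner ℂ z ((α^[n] x : ψ.H →L[ℂ] ψ.H) y) = _
    rw [hα.coe_iterate n hN (hc n) (hceq n)]
    exact inner_betaHat_eq hN hy' hz' (hc _) (hc _)
      (fun i hi => by rw [hceq n i hi]; exact hn.trans (Nat.le_add_left _ _))
      (fun i hi => by rw [hceq _ i hi]; exact Nat.le_add_left _ _)
  exact (tendsto_const_nhds.congr' hconst.symm).cauchySeq

theorem fixed_le_M : ψ.fixed ≤ ψ.M.toStarSubalgebra := fun _ hx => hx.1

theorem R_le_M : ψ.R ≤ ψ.M.toStarSubalgebra := by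
  rw [R_eq]
  refine StarSubalgebra.topologicalClosure_minimal (StarAlgebra.adjoin_le
    (Set.union_subset fixed_le_M (Set.iUnion_subset fun i => ?_))) (Set.isClosed_centralizer _)
  rintro _ ⟨a, rfl⟩
  exact StarAlgebra.adjoin_le_centralizer_centralizer ℂ _
    (StarAlgebra.subset_adjoin ℂ _ ⟨lam i a, rfl⟩)

/-- A permutation that moves only the first `n` indices fixes the range of the `n`-th power of the
shift. -/
theorem IsShift.betaHat_iterate (hα : ψ.IsShift α) {σ : Equiv.Perm ℕ} (hσ : IsFinitary σ) {n : ℕ}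
    (h : ∀ i, n ≤ i → σ i = i) (x : ψ.R) :
    ψ.betaHat σ (α^[n] x : ψ.R) = (α^[n] x : ψ.R) := by
  have hcont := continuous_coe_iterate α n
  refine congrFun (Continuous.ext_on ψ.dense_algR ((ψ.continuous_betaHat σ).comp hcont) hcont
    fun y hy => ?_) x
  obtain ⟨N, hN⟩ := exists_mem_localOps hy
  obtain ⟨ρ, hρ, hρeq⟩ := exists_finitary_add N n
  change ψ.betaHat σ (α^[n] y : ψ.R) = (α^[n] y : ψ.R)
  rw [hα.coe_iterate n hN hρ hρeq, betaHat_betaHat]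
  refine betaHat_eq_of_mem_localOps hN (hσ.mul hρ) hρ fun i hi => ?_
  rw [Equiv.Perm.mul_apply, hρeq i hi, h _ (Nat.le_add_left _ _)]

/-- The vector `1̂` is fixed by every `U_σ`, so its state is invariant under the shift. -/
theorem IsShift.vectorState_iterate (hα : ψ.IsShift α) (n : ℕ) (x : ψ.R) :
    ψ.vectorState (α^[n] x : ψ.R) = ψ.vectorState x := by
  have hv : Continuous ψ.vectorState :=
    continuous_const.inner (ContinuousLinearMap.apply ℂ ψ.H (ψ.hat 1)).continuous
  refine congrFun (Continuous.ext_on ψ.dense_algR (hv.comp (continuous_coe_iterate α n))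
    (hv.comp continuous_subtype_val) fun y hy => ?_) x
  obtain ⟨N, hN⟩ := exists_mem_localOps hy
  obtain ⟨ρ, hρ, hρeq⟩ := exists_finitary_add N n
  change inner ℂ (ψ.hat 1) ((α^[n] y : ψ.H →L[ℂ] ψ.H) (ψ.hat 1)) =
    inner ℂ (ψ.hat 1) ((y : ψ.H →L[ℂ] ψ.H) (ψ.hat 1))
  rw [hα.coe_iterate n hN hρ hρeq, inner_betaHat_eq hN (hat_one_mem_localVectors 0)
    (hat_one_mem_localVectors 0) hρ IsFinitary.one (fun _ _ => Nat.zero_le _)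
    (fun _ _ => Nat.zero_le _), betaHat_one]

section Limit

variable {G : ψ.R →L[ℂ] (ψ.H →L[ℂ] ψ.H)} (hG : ∀ x : ψ.R, Tendsto
  (fun n : ℕ => ContinuousLinearMapWOT.ofCLM ((α^[n] x : ψ.R) : ψ.H →L[ℂ] ψ.H)) atTop
  (𝓝 (ContinuousLinearMapWOT.ofCLM (G x))))

include hG

theorem IsShift.limit_mem_fixed (hα : ψ.IsShift α) (x : ψ.R) : G x ∈ ψ.fixed := by
  refine ⟨mem_vonNeumannGenerated_of_tendsto_wot (hG x)
    (Eventually.of_forall fun n => R_le_M (α^[n] x).2), fun σ hσ => ?_⟩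
  obtain ⟨K, hK⟩ := hσ.exists_bound
  rw [betaHat_eq_iff]
  refine commute_of_tendsto_wot (hG x) ?_
  filter_upwards [eventually_ge_atTop K] with n hn
  exact (ψ.betaHat_eq_iff _ _ _).1 (hα.betaHat_iterate hσ (fun i hi => hK i (hn.trans hi)) x)

theorem IsShift.limit_of_mem_fixed (hα : ψ.IsShift α) {x : ψ.R}
    (hx : (x : ψ.H →L[ℂ] ψ.H) ∈ ψ.fixed) : G x = x := by
  refine ContinuousLinearMapWOT.ofCLM_injective (tendsto_nhds_unique (hG x) ?_)
  simp only [hα.iterate_fixed _ hx]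
  exact tendsto_const_nhds

theorem IsShift.vectorState_limit (hα : ψ.IsShift α) (x : ψ.R) :
    ψ.vectorState (G x) = ψ.vectorState x := by
  have h := ContinuousLinearMapWOT.tendsto_iff_forall_inner_apply_tendsto.1 (hG x) (ψ.hat 1)
    (ψ.hat 1)
  refine tendsto_nhds_unique h (tendsto_const_nhds.congr fun n => ?_)
  exact (hα.vectorState_iterate n x).symm

theorem limit_apply_shift (x : ψ.R) : G (α x) = G x :=
  ContinuousLinearMapWOT.ofCLM_injective
    (tendsto_nhds_unique (hG (α x)) ((tendsto_add_atTop_iff_nat 1).2 (hG x)))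

/-- `αⁿ(β̂_σ(x))` and `αⁿ(x)` are images of `x` under permutations that move its indices to `n` and
beyond, so their matrix coefficients at local vectors agree for large `n`. -/
theorem IsShift.limit_betaHat_of_mem_localOps (hα : ψ.IsShift α) {σ : Equiv.Perm ℕ}
    (hσ : IsFinitary σ) {x w : ψ.R} (hw : (w : ψ.H →L[ℂ] ψ.H) = ψ.betaHat σ x) {N : ℕ}
    (hN : (x : ψ.H →L[ℂ] ψ.H) ∈ ψ.localOps N) : G w = G x := by
  obtain ⟨N', hN'⟩ : ∃ N', ∀ i < N, σ i < N' :=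
    ⟨(Finset.range N).sup σ + 1, fun i hi =>
      Nat.lt_succ_of_le (Finset.le_sup (Finset.mem_range.2 hi))⟩
  have hwN : (w : ψ.H →L[ℂ] ψ.H) ∈ ψ.localOps N' := by
    rw [hw]
    exact betaHat_mem_localOps hN hσ hN'
  refine eq_of_inner_eq_of_dense ψ.dense_iUnion_localVectors fun y hy z hz => ?_
  obtain ⟨K₁, hy⟩ := Set.mem_iUnion.1 hy
  obtain ⟨K₂, hz⟩ := Set.mem_iUnion.1 hz
  have h1 := ContinuousLinearMapWOT.tendsto_iff_forall_inner_apply_tendsto.1 (hG w) y z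
  have h2 := ContinuousLinearMapWOT.tendsto_iff_forall_inner_apply_tendsto.1 (hG x) y z
  refine tendsto_nhds_unique_of_eventuallyEq h1 h2 ?_
  filter_upwards [eventually_ge_atTop (max K₁ K₂)] with n hn
  obtain ⟨ρ, hρ, hρeq⟩ := exists_finitary_add N n
  obtain ⟨ρ', hρ', hρ'eq⟩ := exists_finitary_add N' n
  change inner ℂ z ((α^[n] w : ψ.H →L[ℂ] ψ.H) y) = inner ℂ z ((α^[n] x : ψ.H →L[ℂ] ψ.H) y)
  rw [hα.coe_iterate n hwN hρ' hρ'eq, hα.coe_iterate n hN hρ hρeq, hw, betaHat_betaHat]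
  refine inner_betaHat_eq hN (localVectors_mono ((le_max_left _ _).trans hn) hy)
    (localVectors_mono ((le_max_right _ _).trans hn) hz) (hρ'.mul hσ) hρ (fun i hi => ?_)
    (fun i hi => ?_)
  · rw [Equiv.Perm.mul_apply, hρ'eq _ (hN' i hi)]
    exact Nat.le_add_left _ _
  · rw [hρeq i hi]
    exact Nat.le_add_left _ _

theorem IsShift.limit_betaHat (hα : ψ.IsShift α) {σ : Equiv.Perm ℕ} (hσ : IsFinitary σ) (x : ψ.R) :
    G ⟨ψ.betaHat σ x, ψ.betaHat_mem_R hσ x.2⟩ = G x := by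
  have hcont : Continuous fun x : ψ.R =>
      (⟨ψ.betaHat σ x, ψ.betaHat_mem_R hσ x.2⟩ : ψ.R) :=
    ((ψ.continuous_betaHat σ).comp continuous_subtype_val).subtype_mk _
  refine congrFun (Continuous.ext_on ψ.dense_algR (G.continuous.comp hcont) G.continuous
    fun y hy => ?_) x
  obtain ⟨N, hN⟩ := exists_mem_localOps hy
  exact hα.limit_betaHat_of_mem_localOps hG hσ rfl hN

end Limit

/-! ### The tail algebra -/

/-- A finitary permutation moves only indices below some `N`, so its unitary commutes with
`πᵢ(A)` for `i ≥ N`, hence with the von Neumann algebra generated by these. -/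
theorem tail_le_fixed : ψ.tail ≤ ψ.fixed := by
  intro x hx
  have hx' : ∀ N, x ∈ (vonNeumannGenerated (⋃ i ≥ N, Set.range (ψ.rep i))).toStarSubalgebra :=
    StarSubalgebra.mem_iInf.1 hx
  refine ⟨vonNeumannGenerated_mono ?_ (hx' 0), fun σ hσ => ?_⟩
  · refine Set.iUnion₂_subset fun i _ => ?_
    rintro _ ⟨a, rfl⟩
    exact ⟨lam i a, rfl⟩
  · obtain ⟨K, hK⟩ := hσ.exists_bound
    rw [betaHat_eq_iff]
    refine ((StarSubalgebra.mem_centralizer_iff ℂ).1 (hx' K) _ ?_).1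
    refine (StarSubalgebra.mem_centralizer_iff ℂ).2 fun g hg => ?_
    obtain ⟨i, hi, a, rfl⟩ := Set.mem_iUnion₂.1 hg
    have hcomm : ∀ b, ψ.rep i b * ((ψ.U σ).toContinuousLinearEquiv : ψ.H →L[ℂ] ψ.H) =
        ((ψ.U σ).toContinuousLinearEquiv : ψ.H →L[ℂ] ψ.H) * ψ.rep i b := fun b =>
      ((ψ.betaHat_eq_iff _ _ _).1 (by rw [betaHat_rep, hK i hi])).symm
    exact ⟨hcomm a, by rw [← map_star]; exact hcomm (star a)⟩

variable (ψ) in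
theorem tail_le_Q : ψ.tail ≤ ψ.Q := by
  rw [Q_eq]
  exact fun x hx => StarSubalgebra.le_topologicalClosure _
    (StarAlgebra.subset_adjoin ℂ _ (Or.inl hx))

variable (ψ) in
theorem Q_le_R : ψ.Q ≤ ψ.R :=
  StarSubalgebra.topologicalClosure_mono
    (StarAlgebra.adjoin_mono (Set.union_subset_union_left _ tail_le_fixed))

theorem IsShift.iterate_mem_of_mem_Q (hα : ψ.IsShift α) (n : ℕ) {x : ψ.R}
    (hx : (x : ψ.H →L[ℂ] ψ.H) ∈ ψ.Q) : (α^[n] x : ψ.H →L[ℂ] ψ.H) ∈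
      (vonNeumannGenerated (⋃ i ≥ n, Set.range (ψ.rep i))).toStarSubalgebra := by
  let W := (vonNeumannGenerated (⋃ i ≥ n, Set.range (ψ.rep i))).toStarSubalgebra
  have hW : IsClosed (W : Set (ψ.H →L[ℂ] ψ.H)) := Set.isClosed_centralizer _
  have hpow : ∀ y, (α ^ n) y = α^[n] y := congrFun (coe_pow_endomorphism α n)
  have hcl : IsClosed ((W.comap ψ.R.subtype).comap (α ^ n) : Set ψ.R) :=
    (hW.preimage continuous_subtype_val).preimage (continuous_endomorphism (α ^ n))
  have hmem := mem_of_mem_adjoin_closure ψ.isClosed_R hcl (fun y hy => ?_) x (ψ.Q_eq.le hx)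
  · rw [← hpow]
    exact hmem
  · rcases hy with hy | hy
    · refine ⟨ψ.fixed_le_R (tail_le_fixed hy), ?_⟩
      change ((α ^ n) _ : ψ.H →L[ℂ] ψ.H) ∈ W
      rw [hpow, hα.iterate_fixed n (tail_le_fixed hy)]
      exact StarSubalgebra.mem_iInf.1 hy n
    · obtain ⟨i, a, rfl⟩ := Set.mem_iUnion.1 hy
      refine ⟨ψ.rep_mem_R i a, ?_⟩
      change ((α ^ n) _ : ψ.H →L[ℂ] ψ.H) ∈ W
      rw [hpow, hα.iterate_rep]
      exact StarAlgebra.adjoin_le_centralizer_centralizer ℂ _ (StarAlgebra.subset_adjoin ℂ _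
        (Set.mem_iUnion₂.2 ⟨i + n, Nat.le_add_left _ _, a, rfl⟩))

/-- On `𝓠_ψ` the limit of the powers of the shift lies in the tail algebra. -/
theorem IsShift.limit_mem_tail (hα : ψ.IsShift α) {G : ψ.R →L[ℂ] (ψ.H →L[ℂ] ψ.H)} {x : ψ.R}
    (hG : Tendsto
      (fun n : ℕ => ContinuousLinearMapWOT.ofCLM ((α^[n] x : ψ.R) : ψ.H →L[ℂ] ψ.H)) atTop
      (𝓝 (ContinuousLinearMapWOT.ofCLM (G x))))
    (hx : (x : ψ.H →L[ℂ] ψ.H) ∈ ψ.Q) : G x ∈ ψ.tail := by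
  refine StarSubalgebra.mem_iInf.2 fun N => mem_vonNeumannGenerated_of_tendsto_wot hG ?_
  filter_upwards [eventually_ge_atTop N] with n hn
  refine vonNeumannGenerated_mono ?_ (hα.iterate_mem_of_mem_Q n hx)
  exact Set.iUnion₂_mono' fun i hi => ⟨i, le_trans hn hi, le_rfl⟩

variable (ψ) in
theorem nontrivial_H : Nontrivial ψ.H := by
  refine ⟨ψ.hat 1, 0, fun h => one_ne_zero (α := ℂ) ?_⟩
  have h1 := ψ.inner_hat 1 1
  rw [h, inner_zero_left, star_one, mul_one, ψ.map_one] at h1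
  exact h1.symm

end SymmetricState

end SymState

theorem mainTheorem7 {A : Type u} [CStarAlgebra A] (ψ : SymState.SymmetricState A) :
    ∃ α : ψ.R →⋆ₐ[ℂ] ψ.R, ψ.IsShift α ∧ (∀ α' : ψ.R →⋆ₐ[ℂ] ψ.R, ψ.IsShift α' → α' = α) ∧
      ∃ G : ψ.R →L[ℂ] (ψ.H →L[ℂ] ψ.H),
        (∀ x : ψ.R, Filter.Tendsto
          (fun n : ℕ => ContinuousLinearMapWOT.ofCLM ((α^[n] x : ψ.R) : ψ.H →L[ℂ] ψ.H))
          Filter.atTop (nhds (ContinuousLinearMapWOT.ofCLM (G x)))) ∧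
        SymState.IsConditionalExpectation ψ.R ψ.fixed G ∧
        (∀ x : ψ.R, ψ.vectorState (G x) = ψ.vectorState x) ∧
        (∀ x : ψ.R, G (α x) = G x) ∧
        (∀ σ : Equiv.Perm ℕ, SymState.IsFinitary σ →
          ∀ x : ψ.R, ∃ h : ψ.betaHat σ x ∈ ψ.R, G ⟨ψ.betaHat σ x, h⟩ = G x) ∧
        ∃ h : ψ.Q ≤ ψ.R,
          SymState.IsConditionalExpectation ψ.Q ψ.tail (SymState.restrictTo h G) := by
  have := ψ.nontrivial_H
  obtain ⟨α, hα, -⟩ := ψ.exists_shift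
  obtain ⟨G, hnorm, hG⟩ := hα.exists_limit
  refine ⟨α, hα, fun α' hα' => hα.eq hα', G, hG, ?_, hα.vectorState_limit hG,
    SymState.SymmetricState.limit_apply_shift hG,
    fun σ hσ x => ⟨ψ.betaHat_mem_R hσ x.2, hα.limit_betaHat hG hσ x⟩, ψ.Q_le_R, ?_⟩
  · exact SymState.isConditionalExpectation_of_contractive ψ.fixed_le_R (hα.limit_mem_fixed hG)
      (fun x hx => hα.limit_of_mem_fixed hG hx) hnorm
  · exact SymState.isConditionalExpectation_restrictTo ψ.Q_le_R ψ.tail_le_Q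
      (fun x hx => hα.limit_mem_tail (hG x) hx)
      (fun x hx => hα.limit_of_mem_fixed hG (SymState.SymmetricState.tail_le_fixed hx)) hnorm
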